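/- Let $n\ge 1$, $A_i>0$, $T_i>0$ $(1\le i\le n)$ and $\tau\in\mathbb R$ with $\tau\ne m\,T_i/2$ for all $m\in\mathbb Z$ and all $i$. Let $W_i\subset\mathbb R^2$ be the ellipse (a closed curve) centred at the origin with radii $\alpha_i=A_i\sqrt{1+\cos(2\pi\tau/T_i)}$ and $\beta_i=A_i\sqrt{1-\cos(2\pi\tau/T_i)}$, i.e. the curve $t\mapsto(\alpha_i\cos t,\beta_i\sin t)$ rotated by $+45^\circ$ or $-45^\circ$ (the sign may depend on $i$). Put $W=\bigcup_{i=1}^n W_i$ and let $\beta_s$ be the smallest of the $2n$ radii $\alpha_i,\beta_i$. For $P\subseteq\mathbb R^2$ let the Čech complex of $P$ at scale $r$ have as simplices the finite non-empty $\sigma\subseteq P$ whose closed $r$-balls have a common point in $\mathbb R^2$, and let the Vietoris–Rips complex at scale $r$ have as simplices the finite non-empty $\sigma\subseteq P$ of diameter at most $2r$. Consider simplicial homology with coefficients in an arbitrary field. A 1-dimensional persistent bar with birth $b$ and death $d$, $b<d$, is an interval $I\subset\mathbb R$ with $\inf I=b$, $\sup I=d$, whose interval module is a direct summand of the persistence module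 $r\mapsto H_1$ of the filtration. Then the persistence diagram of $W$ has at least one 1-dimensional persistent bar, born at (or, for samples, near) $0$ and dying at about $\beta_s$; precisely: 1. (Continuous case.) The Čech filtration of $W$ has a 1-dimensional bar with birth $0$ and death exactly $\beta_s$. The Vietoris–Rips filtration of $W$ has a 1-dimensional bar with birth $0$ and death $d$, $\frac{\sqrt3}{2}\beta_s\le d\le\beta_s$. 2. (Discrete case.) Let $P\subseteq W$ be finite and such that every point of $W$ is within distance $\delta$ of $P$. If $\delta<\beta_s$, the Čech filtration of $P$ has a 1-dimensional bar with birth $b\in[0,\delta]$ and death $d\in[\beta_s,\beta_s+\delta]$. If $\delta<\frac{\sqrt3}{2}\beta_s$, the Vietoris–Rips filtration of $P$ has a 1-dimensional bar with birth $b\in[0,\delta]$ and death $d\in[\frac{\sqrt3}{2}\beta_s,\beta_s+\delta]$. -/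

import Mathlib

open CategoryTheory

noncomputable section

/-! ### Homology of a simplicial complex over a field -/

/-- The quotient of a submodule `Z` by (its intersection with) a submodule `B`. -/
abbrev Subquotient {R M : Type*} [Ring R] [AddCommGroup M] [Module R M] (Z B : Submodule R M) :=
  Z ⧸ B.submoduleOf Z

/-- The map `Z / B → Z' / B'` induced by inclusions `Z ≤ Z'` and `B ≤ B'`. -/
def subquotientMap {R M : Type*} [Ring R] [AddCommGroup M] [Module R M]
    {Z B Z' B' : Submodule R M} (hZ : Z ≤ Z') (hB : B ≤ B') :
    Subquotient Z B →ₗ[R] Subquotient Z' B' :=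
  Submodule.mapQ _ _ (Submodule.inclusion hZ) fun _ hx => hB hx

/-- The boundary operator on ordered tuples,
`∂ (v₀, …, vₙ₊₁) = ∑ᵢ (-1)ⁱ (v₀, …, v̂ᵢ, …, vₙ₊₁)`, extended linearly. -/
def boundary (k : Type*) [Field k] (V : Type) (n : ℕ) :
    ((Fin (n + 2) → V) →₀ k) →ₗ[k] ((Fin (n + 1) → V) →₀ k) :=
  Finsupp.linearCombination k fun σ =>
    ∑ i : Fin (n + 2), (-1 : k) ^ (i : ℕ) • Finsupp.single (fun j => σ (i.succAbove j)) (1 : k)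

/-- Ordered `n`-chains of `K`: formal combinations of tuples `(v₀, …, vₙ)`, repetitions allowed,
whose entries are vertices of one face of `K`.  The ordered chain complex computes the simplicial
homology of `K`. -/
def chains (k : Type*) [Field k] {V : Type} (K : PreAbstractSimplicialComplex V) (n : ℕ) :
    Submodule k ((Fin (n + 1) → V) →₀ k) :=
  Finsupp.supported k k {σ | ∃ s ∈ K, ∀ i, σ i ∈ s}

/-- The `n`-cycles of `K`. -/
def cycles (k : Type*) [Field k] {V : Type} (K : PreAbstractSimplicialComplex V) :
    (n : ℕ) → Submodule k ((Fin (n + 1) → V) →₀ k)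
  | 0 => chains k K 0
  | n + 1 => chains k K (n + 1) ⊓ LinearMap.ker (boundary k V n)

/-- The `n`-boundaries of `K`. -/
def boundaries (k : Type*) [Field k] {V : Type} (K : PreAbstractSimplicialComplex V) (n : ℕ) :
    Submodule k ((Fin (n + 1) → V) →₀ k) :=
  (chains k K (n + 1)).map (boundary k V n)

theorem chains_mono (k : Type*) [Field k] {V : Type} {K L : PreAbstractSimplicialComplex V}
    (h : K ≤ L) (n : ℕ) : chains k K n ≤ chains k L n :=
  Finsupp.supported_mono fun _ ⟨s, hs, hσ⟩ => ⟨s, h hs, hσ⟩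

theorem cycles_mono (k : Type*) [Field k] {V : Type} {K L : PreAbstractSimplicialComplex V}
    (h : K ≤ L) : ∀ n : ℕ, cycles k K n ≤ cycles k L n
  | 0 => chains_mono k h 0
  | n + 1 => inf_le_inf_right _ (chains_mono k h (n + 1))

theorem boundaries_mono (k : Type*) [Field k] {V : Type} {K L : PreAbstractSimplicialComplex V}
    (h : K ≤ L) (n : ℕ) : boundaries k K n ≤ boundaries k L n :=
  Submodule.map_mono (chains_mono k h (n + 1))

/-- The `n`-th simplicial homology of `K` with coefficients in `k`: cycles modulo boundaries. -/
abbrev Homology (k : Type*) [Field k] {V : Type} (K : PreAbstractSimplicialComplex V) (n : ℕ) :=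
  Subquotient (cycles k K n) (boundaries k K n)

/-- The map induced on homology by an inclusion of simplicial complexes. -/
def homologyMap (k : Type*) [Field k] {V : Type} {K L : PreAbstractSimplicialComplex V}
    (h : K ≤ L) (n : ℕ) : Homology k K n →ₗ[k] Homology k L n :=
  subquotientMap (cycles_mono k h n) (boundaries_mono k h n)

/-! ### Persistent homology and persistence diagrams -/

/-- The `n`-th persistent homology of a filtration of simplicial complexes indexed by `ℝ`. -/
def persistentHomology (k : Type*) [Field k] {V : Type}
    (F : ℝ →o PreAbstractSimplicialComplex V) (n : ℕ) : ℝ ⥤ ModuleCat k where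
  obj r := ModuleCat.of k (Homology k (F r) n)
  map {_ _} f := ModuleCat.ofHom (homologyMap k (F.monotone (leOfHom f)) n)
  map_id _ := ModuleCat.hom_ext <| LinearMap.ext fun x => by
    obtain ⟨x, rfl⟩ := Submodule.Quotient.mk_surjective _ x
    rfl
  map_comp _ _ := ModuleCat.hom_ext <| LinearMap.ext fun x => by
    obtain ⟨x, rfl⟩ := Submodule.Quotient.mk_surjective _ x
    rfl

open Classical in
/-- The interval module of an interval `I`: it is `k` at the parameters in `I` (with identity
maps between them) and `0` elsewhere. -/
def intervalModule (k : Type*) [Field k] (I : Set ℝ) (hI : I.OrdConnected) :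
    ℝ ⥤ ModuleCat k where
  obj r := ModuleCat.of k (PLift (r ∈ I) → k)
  map {r s} _ := ModuleCat.ofHom
    { toFun := fun g _ => if hr : r ∈ I then g ⟨hr⟩ else 0
      map_add' := fun g g' => by
        funext _
        by_cases hr : r ∈ I <;> simp [hr]
      map_smul' := fun c g => by
        funext _
        by_cases hr : r ∈ I <;> simp [hr] }
  map_id r := ModuleCat.hom_ext <| LinearMap.ext fun g => by
    funext hr
    simp [hr.down]
  map_comp {r s t} f g := ModuleCat.hom_ext <| LinearMap.ext fun x => by
    funext ht
    by_cases hr : r ∈ I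
    · have hs : s ∈ I := hI.out hr ht.down ⟨leOfHom f, leOfHom g⟩
      simp [hr, hs]
    · simp [hr]

/-- `I` is a bar of the persistence module `M`: the interval module of `I` is a direct summand
of `M`. -/
def IsBar {k : Type*} [Field k] (M : ℝ ⥤ ModuleCat k) (I : Set ℝ) (hI : I.OrdConnected) : Prop :=
  Nonempty (Retract (intervalModule k I hI) M)

/-- `(b, d)` is an (off-diagonal, finite) point of the persistence diagram of `M`: there is a bar
of `M` with birth time `b` and death time `d`. -/
def IsDiagramPoint {k : Type*} [Field k] (M : ℝ ⥤ ModuleCat k) (b d : ℝ) : Prop :=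
  b < d ∧ ∃ (I : Set ℝ) (hI : I.OrdConnected), IsGLB I b ∧ IsLUB I d ∧ IsBar M I hI

/-! ### The Čech and Vietoris–Rips filtrations of a set of points -/

/-- The Čech filtration of `P`: at scale `r`, finitely many points of `P` span a face when the
closed balls of radius `r` around them have a common point in the ambient space. -/
def cech {X : Type} [MetricSpace X] (P : Set X) : ℝ →o PreAbstractSimplicialComplex X where
  toFun r :=
    { faces := {s | s.Nonempty ∧ (s : Set X) ⊆ P ∧ ∃ c, ∀ p ∈ s, dist p c ≤ r}
      isRelLowerSet_faces := fun _ ⟨hne, hP, c, hc⟩ =>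
        ⟨hne, fun _ hts ht =>
          ⟨ht, fun _ hx => hP (hts hx), c, fun p hp => hc p (hts hp)⟩⟩ }
  monotone' := fun _ _ hrs _ ⟨hne, hP, c, hc⟩ =>
    ⟨hne, hP, c, fun p hp => (hc p hp).trans hrs⟩

/-- The Vietoris–Rips filtration of `P`: at scale `r`, finitely many points of `P` span a face
when their diameter is at most `2r`, i.e. when their
pairwise distances are at most `2r`. -/
def rips {X : Type} [MetricSpace X] (P : Set X) : ℝ →o PreAbstractSimplicialComplex X where
  toFun r :=
    { faces := {s | s.Nonempty ∧ (s : Set X) ⊆ P ∧ ∀ p ∈ s, ∀ q ∈ s, dist p q ≤ 2 * r}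
      isRelLowerSet_faces := fun _ ⟨hne, hP, hc⟩ =>
        ⟨hne, fun _ hts ht =>
          ⟨ht, fun _ hx => hP (hts hx), fun p hp q hq => hc p (hts hp) q (hts hq)⟩⟩ }
  monotone' := fun _ _ hrs _ ⟨hne, hP, hc⟩ =>
    ⟨hne, hP, fun p hp q hq => (hc p hp q hq).trans (by linarith)⟩

/-! ### Ellipses -/

/-- The ellipse (a curve) centred at the origin with radii `a`, `b`: the image of
`t ↦ (a cos t, b sin t)` under the rotation by the angle `θ`. -/
def ellipse (a b θ : ℝ) : Set (EuclideanSpace ℝ (Fin 2)) :=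
  Set.range fun t : ℝ =>
    !₂[a * Real.cos t * Real.cos θ - b * Real.sin t * Real.sin θ,
       a * Real.cos t * Real.sin θ + b * Real.sin t * Real.cos θ]

/-- The first radius `A √(1 + cos (2πτ/T))`. -/
def radiusPlus (A T τ : ℝ) : ℝ := A * √(1 + Real.cos (2 * Real.pi * τ / T))

/-- The second radius `A √(1 - cos (2πτ/T))`. -/
def radiusMinus (A T τ : ℝ) : ℝ := A * √(1 - Real.cos (2 * Real.pi * τ / T))

/-- The union of the `n` concentric ellipses with radii `Aᵢ √(1 ± cos (2πτ/Tᵢ))` and angles of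
rotation `θᵢ`. -/
def ellipseUnion {n : ℕ} (A T θ : Fin n → ℝ) (τ : ℝ) : Set (EuclideanSpace ℝ (Fin 2)) :=
  ⋃ i, ellipse (radiusPlus (A i) (T i) τ) (radiusMinus (A i) (T i) τ) (θ i)

end

/-!
The smallest radius `β` belongs to an ellipse `E` in the union `W`, and `W` lies outside the open
disc of radius `β`. Consider the class of a fine polygon inscribed in `E`, or of its image under a
nearest-point map when only a `δ`-dense sample is given (`loopChain`).

*The class survives.* If the origin is not in the hull of any three vertices of a face, the signed
number of crossings of a half-line is a cocycle (`crossing_add`), and it takes the value `1` on the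
polygon (`winding_loopChain`). Faces avoid the origin in the Čech complex at scales `r < β`
(`avoidsOrigin_cech`) and in the Vietoris–Rips complex at scales `r < (√3 / 2) β`, because three
points whose triangle contains the origin subtend an angle of at least `2π/3`
(`avoidsOrigin_rips`).

*The class dies.* Let `β` be the second radius. The points of `E` with parameters `t` and `-t` are
within `β` of the point of the first axis midway between them, so for `r > β` (and `r > β + δ` for a
sample) thin strips between such chords lie in faces of the Čech complex and fill the polygon
(`loopChain_mem_boundaries`). Both facts together are `exists_loop_family`.

*From classes to bars.* A compatible family over an interval `I` that dies after `I` and is nowhere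
in `I` equal to a class coming from before `I` spans a direct summand: a functional on the colimit
over `I` gives the retraction (`isBar_of_family`). For `W` itself there is no homology at scales
`r ≤ 0`, and the scales at which the family of polygons is nonzero form a bar
(`isDiagramPoint_of_family`); whether the death time itself belongs to the bar plays no role. For a
finite sample the polygon may be a sum of several bars, and
`isDiagramPoint_of_class` extracts one that lives long enough by minimising first the birth and then
the death among suitable classes.
-/

noncomputable section

/-! ### Edges, fans and loops modulo boundaries -/

section Edges

variable (k : Type*) [Field k] {V : Type}

/-- The ordered `1`-simplex `(p, q)`, as a chain. -/
def edge (p q : V) : (Fin 2 → V) →₀ k := Finsupp.single ![p, q] 1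

/-- All points of `T` are vertices of one face of `K`. -/
def Spans (K : PreAbstractSimplicialComplex V) (T : Set V) : Prop := ∃ s ∈ K, T ⊆ (s : Set V)

variable {k}

theorem Spans.mono {K L : PreAbstractSimplicialComplex V} (h : K ≤ L) {S T : Set V} (hST : S ⊆ T)
    (hT : Spans K T) : Spans L S :=
  let ⟨s, hs, hTs⟩ := hT
  ⟨s, h hs, hST.trans hTs⟩

theorem boundary_edge (p q : V) :
    boundary k V 0 (edge k p q) = Finsupp.single ![q] 1 - Finsupp.single ![p] 1 := by
  have h0 : (fun j : Fin 1 => (![p, q] : Fin 2 → V) ((0 : Fin 2).succAbove j)) = ![q] := by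
    ext j; fin_cases j; rfl
  have h1 : (fun j : Fin 1 => (![p, q] : Fin 2 → V) ((1 : Fin 2).succAbove j)) = ![p] := by
    ext j; fin_cases j; rfl
  simp only [boundary, edge, Finsupp.linearCombination_single, one_smul]
  refine (Fin.sum_univ_two _).trans ?_
  rw [h0, h1]
  simp [sub_eq_add_neg]

theorem boundary_triple (σ : Fin 3 → V) :
    boundary k V 1 (Finsupp.single σ 1) =
      edge k (σ 1) (σ 2) - edge k (σ 0) (σ 2) + edge k (σ 0) (σ 1) := by
  have h0 : (fun j : Fin 2 => σ ((0 : Fin 3).succAbove j)) = ![σ 1, σ 2] := by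
    ext j; fin_cases j <;> rfl
  have h1 : (fun j : Fin 2 => σ ((1 : Fin 3).succAbove j)) = ![σ 0, σ 2] := by
    ext j; fin_cases j <;> rfl
  have h2 : (fun j : Fin 2 => σ ((2 : Fin 3).succAbove j)) = ![σ 0, σ 1] := by
    ext j; fin_cases j <;> rfl
  simp only [boundary, edge, Finsupp.linearCombination_single, one_smul]
  refine (Fin.sum_univ_three _).trans ?_
  rw [h0, h1, h2]
  simp [sub_eq_add_neg]

theorem edge_mem_chains {K : PreAbstractSimplicialComplex V} {p q : V} (h : Spans K {p, q}) :
    edge k p q ∈ chains k K 1 := by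
  obtain ⟨s, hs, hT⟩ := h
  refine Finsupp.single_mem_supported k _ ⟨s, hs, fun i => ?_⟩
  fin_cases i
  · exact hT (by simp)
  · exact hT (by simp)

variable (k) in
/-- The ordered edge `(p, q)` modulo the boundaries of `K`. -/
def edgeClass (K : PreAbstractSimplicialComplex V) (p q : V) :
    ((Fin 2 → V) →₀ k) ⧸ boundaries k K 1 :=
  (boundaries k K 1).mkQ (edge k p q)

theorem edgeClass_add {K : PreAbstractSimplicialComplex V} {p q r : V} (h : Spans K {p, q, r}) :
    edgeClass k K p q + edgeClass k K q r = edgeClass k K p r := by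
  obtain ⟨s, hs, hT⟩ := h
  have hmem : (Finsupp.single ![p, q, r] 1 : (Fin 3 → V) →₀ k) ∈ chains k K 2 := by
    refine Finsupp.single_mem_supported k _ ⟨s, hs, fun i => ?_⟩
    fin_cases i <;> exact hT (by simp)
  have hb := boundary_triple (k := k) ![p, q, r]
  have : (boundaries k K 1).mkQ (edge k q r - edge k p r + edge k p q) = 0 := by
    rw [Submodule.mkQ_apply, Submodule.Quotient.mk_eq_zero]
    exact ⟨_, hmem, hb⟩
  rw [map_add, map_sub] at this
  unfold edgeClass
  rw [← sub_eq_zero, ← this]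
  abel

theorem edgeClass_self {K : PreAbstractSimplicialComplex V} {p : V} (h : Spans K {p}) :
    edgeClass k K p p = 0 := by
  have := edgeClass_add (k := k) (K := K) (p := p) (q := p) (r := p) (by simpa using h)
  simpa using this

/-- A square whose corners span a face is filled. -/
theorem edgeClass_square {K : PreAbstractSimplicialComplex V} {p q p' q' : V}
    (h : Spans K {p, q, p', q'}) :
    edgeClass k K p q + edgeClass k K q q' = edgeClass k K p p' + edgeClass k K p' q' := by
  rw [edgeClass_add (h.mono le_rfl (by intro x; simp; tauto)),
    edgeClass_add (h.mono le_rfl (by intro x; simp; tauto))]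

variable (k) in
/-- The closed polygon through the values of `g` at the `2N` points `± π j / N`, run through in the
positive sense: the half over `[0, π]` together with the half over `[-π, 0]`. It is a cycle when
`g π = g (-π)`. -/
def loopChain (g : ℝ → V) (N : ℕ) : (Fin 2 → V) →₀ k :=
  ∑ j ∈ Finset.range N,
    (edge k (g (Real.pi * j / N)) (g (Real.pi * (j + 1 : ℕ) / N)) +
      edge k (g (-(Real.pi * (j + 1 : ℕ) / N))) (g (-(Real.pi * j / N))))

theorem loopChain_mem_cycles {K : PreAbstractSimplicialComplex V} {g : ℝ → V} {N : ℕ}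
    (hN : N ≠ 0) (hg : g Real.pi = g (-Real.pi))
    (hK : ∀ s t : ℝ, |s - t| ≤ Real.pi / N → Spans K {g s, g t}) :
    loopChain k g N ∈ cycles k K 1 := by
  have hN' : (N : ℝ) ≠ 0 := by exact_mod_cast hN
  have hpi := Real.pi_pos
  have hd : ∀ j : ℕ, Real.pi * (j + 1 : ℕ) / N - Real.pi * j / N = Real.pi / N := by
    intro j; push_cast; field_simp; ring
  have habs : |Real.pi / (N : ℝ)| = Real.pi / N := abs_of_nonneg (by positivity)
  refine ⟨Submodule.sum_mem _ fun j _ => Submodule.add_mem _ (edge_mem_chains (hK _ _ ?_))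
    (edge_mem_chains (hK _ _ ?_)), ?_⟩
  · rw [abs_sub_comm, hd, habs]
  · rw [← habs, ← hd j, ← abs_neg]
    apply le_of_eq; congr 1; ring
  · rw [SetLike.mem_coe, LinearMap.mem_ker, loopChain, map_sum]
    obtain ⟨D, hD⟩ : ∃ D : ℕ → ((Fin 1 → V) →₀ k), ∀ i, D i =
        Finsupp.single ![g (Real.pi * i / N)] 1 - Finsupp.single ![g (-(Real.pi * i / N))] 1 :=
      ⟨_, fun _ => rfl⟩
    have : ∀ j ∈ Finset.range N, boundary k V 0
        (edge k (g (Real.pi * j / N)) (g (Real.pi * (j + 1 : ℕ) / N)) +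
          edge k (g (-(Real.pi * (j + 1 : ℕ) / N))) (g (-(Real.pi * j / N)))) =
        D (j + 1) - D j := by
      intro j _
      simp only [map_add, boundary_edge, hD]
      abel
    rw [Finset.sum_congr rfl this, Finset.sum_range_sub, hD, hD]
    simp [hN', hg]

theorem mkQ_loopChain (K : PreAbstractSimplicialComplex V) (g : ℝ → V) (N : ℕ) :
    (boundaries k K 1).mkQ (loopChain k g N) = ∑ j ∈ Finset.range N,
      (edgeClass k K (g (Real.pi * j / N)) (g (Real.pi * (j + 1 : ℕ) / N)) +
        edgeClass k K (g (-(Real.pi * (j + 1 : ℕ) / N))) (g (-(Real.pi * j / N)))) := by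
  simp [loopChain, edgeClass]

theorem sum_range_two_mul {M : Type*} [AddCommMonoid M] (f : ℕ → M) (N : ℕ) :
    ∑ i ∈ Finset.range (2 * N), f i = ∑ j ∈ Finset.range N, (f (2 * j) + f (2 * j + 1)) := by
  induction N with
  | zero => simp
  | succ n ih => rw [Finset.sum_range_succ, ← ih, Nat.mul_succ, Finset.sum_range_succ,
      Finset.sum_range_succ, add_assoc]


theorem edgeClass_add_swap {K : PreAbstractSimplicialComplex V} {p q : V}
    (h : Spans K {p, q}) : edgeClass k K p q + edgeClass k K q p = 0 := by
  rw [edgeClass_add (h.mono le_rfl (by intro x; simp; tauto)),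
    edgeClass_self (h.mono le_rfl (by simp))]

/-- Halving the mesh does not change the class of a loop. -/
theorem mkQ_loopChain_two_mul {K : PreAbstractSimplicialComplex V} {g : ℝ → V} {N : ℕ}
    (hN : N ≠ 0)
    (hK : ∀ s t u : ℝ, |s - t| ≤ Real.pi / N → |u - t| ≤ Real.pi / N →
      Spans K {g s, g t, g u}) :
    (boundaries k K 1).mkQ (loopChain k g (2 * N)) =
      (boundaries k K 1).mkQ (loopChain k g N) := by
  have hN' : (N : ℝ) ≠ 0 := by exact_mod_cast hN
  have hpi := Real.pi_pos
  have hNp : 0 < (N : ℝ) := by positivity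
  rw [mkQ_loopChain, mkQ_loopChain, sum_range_two_mul]
  refine Finset.sum_congr rfl fun j _ => ?_
  have e0 : Real.pi * (2 * j : ℕ) / (2 * N : ℕ) = Real.pi * j / N := by
    push_cast; field_simp
  have e2 : Real.pi * (2 * j + 1 + 1 : ℕ) / (2 * N : ℕ) = Real.pi * (j + 1 : ℕ) / N := by
    push_cast; field_simp; ring
  have d0 : |Real.pi * j / N - Real.pi * (2 * j + 1 : ℕ) / (2 * N : ℕ)| ≤ Real.pi / N := by
    have : Real.pi * j / N - Real.pi * (2 * j + 1 : ℕ) / (2 * N : ℕ) = -(Real.pi / N / 2) := by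
      push_cast; field_simp; ring
    rw [this, abs_neg, abs_of_nonneg (by positivity)]
    exact half_le_self (by positivity)
  have d2 : |Real.pi * (j + 1 : ℕ) / N - Real.pi * (2 * j + 1 : ℕ) / (2 * N : ℕ)| ≤
      Real.pi / N := by
    have : Real.pi * (j + 1 : ℕ) / N - Real.pi * (2 * j + 1 : ℕ) / (2 * N : ℕ) =
        Real.pi / N / 2 := by
      push_cast; field_simp; ring
    rw [this, abs_of_nonneg (by positivity)]
    exact half_le_self (by positivity)
  rw [e0, e2, ← edgeClass_add (hK _ _ _ d0 d2),
    ← edgeClass_add (hK (-(Real.pi * (j + 1 : ℕ) / N))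
      (-(Real.pi * (2 * j + 1 : ℕ) / (2 * N : ℕ))) (-(Real.pi * j / N))
      (by rw [← neg_sub', abs_neg]; exact d2) (by rw [← neg_sub', abs_neg]; exact d0))]
  abel

/-- Two loops are homologous when short pieces of them lie in common faces. -/
theorem mkQ_loopChain_congr {K : PreAbstractSimplicialComplex V} {g g' : ℝ → V} {N : ℕ}
    (hN : N ≠ 0) (hg : g Real.pi = g (-Real.pi)) (hg' : g' Real.pi = g' (-Real.pi))
    (hK : ∀ s t : ℝ, |s - t| ≤ Real.pi / N → Spans K {g s, g t, g' s, g' t}) :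
    (boundaries k K 1).mkQ (loopChain k g N) = (boundaries k K 1).mkQ (loopChain k g' N) := by
  have hN' : (N : ℝ) ≠ 0 := by exact_mod_cast hN
  have hpi := Real.pi_pos
  have hd : ∀ j : ℕ, |Real.pi * j / N - Real.pi * (j + 1 : ℕ) / N| ≤ Real.pi / N := by
    intro j
    have : Real.pi * j / N - Real.pi * (j + 1 : ℕ) / N = - (Real.pi / N) := by
      push_cast; field_simp; ring
    rw [this, abs_neg, abs_of_nonneg (by positivity)]
  have key : ∀ s t : ℝ, |s - t| ≤ Real.pi / N → edgeClass k K (g s) (g t) -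
      edgeClass k K (g' s) (g' t) = edgeClass k K (g s) (g' s) - edgeClass k K (g t) (g' t) := by
    intro s t hst
    have := edgeClass_square (k := k) (hK s t hst)
    exact sub_eq_sub_iff_add_eq_add.mpr this
  obtain ⟨D, hD⟩ : ∃ D : ℕ → ((Fin 2 → V) →₀ k) ⧸ boundaries k K 1, ∀ i, D i =
      edgeClass k K (g (-(Real.pi * i / N))) (g' (-(Real.pi * i / N))) -
        edgeClass k K (g (Real.pi * i / N)) (g' (Real.pi * i / N)) := ⟨_, fun _ => rfl⟩
  rw [← sub_eq_zero, mkQ_loopChain, mkQ_loopChain, ← Finset.sum_sub_distrib]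
  have : ∀ j ∈ Finset.range N,
      (edgeClass k K (g (Real.pi * j / N)) (g (Real.pi * (j + 1 : ℕ) / N)) +
        edgeClass k K (g (-(Real.pi * (j + 1 : ℕ) / N))) (g (-(Real.pi * j / N)))) -
      (edgeClass k K (g' (Real.pi * j / N)) (g' (Real.pi * (j + 1 : ℕ) / N)) +
        edgeClass k K (g' (-(Real.pi * (j + 1 : ℕ) / N))) (g' (-(Real.pi * j / N)))) =
      D (j + 1) - D j := by
    intro j _
    rw [add_sub_add_comm, key _ _ (hd j),
      key _ _ (by rw [← neg_sub', abs_neg, abs_sub_comm]; exact hd j),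
      hD, hD]
    abel_nf
  rw [Finset.sum_congr rfl this, Finset.sum_range_sub, hD, hD]
  simp [hN', hg, hg']

/-- A loop is a boundary when it can be swept out by the chords joining `g t` to `g (-t)`. -/
theorem loopChain_mem_boundaries {K : PreAbstractSimplicialComplex V} {g : ℝ → V} {N : ℕ}
    (hN : N ≠ 0) (hg : g Real.pi = g (-Real.pi))
    (hK : ∀ s t : ℝ, |s - t| ≤ Real.pi / N → Spans K {g s, g t, g (-s), g (-t)}) :
    loopChain k g N ∈ boundaries k K 1 := by
  have hN' : (N : ℝ) ≠ 0 := by exact_mod_cast hN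
  have hpi := Real.pi_pos
  have hd : ∀ j : ℕ, |Real.pi * j / N - Real.pi * (j + 1 : ℕ) / N| ≤ Real.pi / N := by
    intro j
    have : Real.pi * j / N - Real.pi * (j + 1 : ℕ) / N = - (Real.pi / N) := by
      push_cast; field_simp; ring
    rw [this, abs_neg, abs_of_nonneg (by positivity)]
  have hself : ∀ t, edgeClass k K (g t) (g t) = 0 := fun t =>
    edgeClass_self ((hK t t (by simp; positivity)).mono le_rfl (by simp))
  rw [← Submodule.Quotient.mk_eq_zero, ← Submodule.mkQ_apply, mkQ_loopChain]
  have : ∀ j ∈ Finset.range N,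
      (edgeClass k K (g (Real.pi * j / N)) (g (Real.pi * (j + 1 : ℕ) / N)) +
        edgeClass k K (g (-(Real.pi * (j + 1 : ℕ) / N))) (g (-(Real.pi * j / N)))) =
      (fun i : ℕ => edgeClass k K (g (Real.pi * i / N)) (g (-(Real.pi * i / N)))) j -
      (fun i : ℕ => edgeClass k K (g (Real.pi * i / N)) (g (-(Real.pi * i / N)))) (j + 1) := by
    intro j _
    have h1 := edgeClass_square (k := k) (hK _ _ (hd j))
    have h2 := edgeClass_add_swap (k := k)
      ((hK _ _ (hd j)).mono (S := {g (-(Real.pi * j / N)), g (-(Real.pi * (j + 1 : ℕ) / N))})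
        le_rfl (by intro x; simp; tauto))
    simp only
    rw [eq_sub_iff_add_eq, add_right_comm, h1, add_assoc, h2, add_zero]
  rw [Finset.sum_congr rfl this, Finset.sum_range_sub']
  have h0 := hself 0
  have h1 := hself (-Real.pi)
  simp [hN', hg, h0, h1]

/-- The class of the `2 ^ m`-th polygon does not depend on `m` once the mesh is fine. -/
theorem mkQ_loopChain_two_pow {K : PreAbstractSimplicialComplex V} {g : ℝ → V} {m m' : ℕ}
    (hm : m ≤ m')
    (hK : ∀ s t u : ℝ, |s - t| ≤ Real.pi / (2 ^ m : ℕ) → |u - t| ≤ Real.pi / (2 ^ m : ℕ) →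
      Spans K {g s, g t, g u}) :
    (boundaries k K 1).mkQ (loopChain k g (2 ^ m')) =
      (boundaries k K 1).mkQ (loopChain k g (2 ^ m)) := by
  induction m', hm using Nat.le_induction with
  | base => rfl
  | succ i hi ih =>
    have hle : Real.pi / (2 ^ i : ℕ) ≤ Real.pi / (2 ^ m : ℕ) := by
      have := Real.pi_pos
      gcongr
      norm_num
    rw [← ih, pow_succ', mkQ_loopChain_two_mul (by positivity)
      fun s t u hs hu => hK s t u (hs.trans hle) (hu.trans hle)]

end Edges

/-! ### Homology of complexes without edges -/

/-- A complex whose faces are single points has no first homology. -/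
theorem subsingleton_homology_one (k : Type*) [Field k] {V : Type}
    {K : PreAbstractSimplicialComplex V} (hK : ∀ s ∈ K, ∀ p ∈ s, ∀ q ∈ s, p = q) :
    Subsingleton (Homology k K 1) := by
  have hle : chains k K 1 ≤ boundaries k K 1 := by
    unfold chains
    rw [Finsupp.supported_eq_span_single, Submodule.span_le]
    rintro _ ⟨σ, ⟨s, hs, hσ⟩, rfl⟩
    have h1 : σ 1 = σ 0 := hK s hs _ (hσ 1) _ (hσ 0)
    refine ⟨Finsupp.single (fun _ => σ 0) 1,
      Finsupp.single_mem_supported k _ ⟨s, hs, fun _ => hσ 0⟩, ?_⟩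
    rw [boundary_triple]
    have : σ = ![σ 0, σ 0] := by
      ext i; fin_cases i
      · rfl
      · exact h1
    rw [sub_self, zero_add, edge]
    exact congrArg (fun τ => Finsupp.single τ (1 : k)) this.symm
  refine Submodule.Quotient.subsingleton_iff.mpr (eq_top_iff.mpr fun z _ => ?_)
  exact hle z.2.1

/-! ### Recognising bars of a persistence module -/

section Bars

universe u

variable {k : Type u} [Field k]

/-- The structure map `M r → M s` of a persistence module, for `r ≤ s`. -/
def transition (M : ℝ ⥤ ModuleCat.{u} k) {r s : ℝ} (h : r ≤ s) : M.obj r →ₗ[k] M.obj s :=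
  (M.map (homOfLE h)).hom

theorem transition_refl (M : ℝ ⥤ ModuleCat.{u} k) {r : ℝ} (h : r ≤ r) (x : M.obj r) :
    transition M h x = x := by
  have : homOfLE h = 𝟙 r := rfl
  rw [transition, this, M.map_id]
  rfl

theorem transition_trans (M : ℝ ⥤ ModuleCat.{u} k) {r s t : ℝ} (h : r ≤ s) (h' : s ≤ t)
    (x : M.obj r) : transition M h' (transition M h x) = transition M (h.trans h') x := by
  have : homOfLE (h.trans h') = homOfLE h ≫ homOfLE h' := rfl
  rw [transition, transition, transition, this, M.map_comp]
  rfl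

/-- A family that is compatible over `I`, and at no parameter of `I` comes from before `I`, is
detected by a compatible family of functionals over `I` which vanish on everything that comes from
before `I`. -/
theorem exists_dual_family (M : ℝ ⥤ ModuleCat.{u} k) {I : Set ℝ} (hne : I.Nonempty)
    (y : ∀ r, M.obj r)
    (hmap : ∀ (r s : ℝ) (h : r ≤ s), r ∈ I → s ∈ I → transition M h (y r) = y s)
    (h0 : ∀ s ∈ I, y s ≠ 0)
    (hbirth : ∀ (r s : ℝ) (h : r ≤ s), r ∉ I → s ∈ I → ∀ u, transition M h u ≠ y s) :
    ∃ φ : ∀ r : I, M.obj r →ₗ[k] k,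
      (∀ (r s : I) (h : r.1 ≤ s.1) x, φ s (transition M h x) = φ r x) ∧
      (∀ r : I, φ r (y r) = 1) ∧
      ∀ (r : ℝ) (s : I) (h : r ≤ s), r ∉ I → ∀ u, φ s (transition M h u) = 0 := by
  classical
  -- The functionals are obtained on the colimit of `M` over `I`, where the images of the
  -- parameters before `I` form a subspace that does not contain the class of the family.
  let G : I → Type u := fun s => (M.obj s.1 : Type u)
  let f : ∀ i j : I, i ≤ j → G i →ₗ[k] G j := fun i j h => transition M h
  have : Nonempty I := hne.to_subtype
  have : DirectedSystem G (fun i j h => f i j h) :=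
    { map_self := fun i x => transition_refl M _ x
      map_map := fun _ _ _ h h' x => transition_trans M h h' x }
  let o : ∀ i : I, G i →ₗ[k] Module.DirectLimit G f := fun i => Module.DirectLimit.of k I G f i
  have ho : ∀ (i j : I) (h : i.1 ≤ j.1) (x : M.obj i.1), o j (transition M h x) = o i x :=
    fun i j h x => Module.DirectLimit.of_f (f := f) (hij := h)
  let N : Submodule k (Module.DirectLimit G f) := Submodule.span k
    {z | ∃ (r : ℝ) (s : I) (h : r ≤ s), r ∉ I ∧ ∃ u, o s (transition M h u) = z}
  have hN : ∀ z ∈ N, z = 0 ∨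
      ∃ (r : ℝ) (s : I) (h : r ≤ s), r ∉ I ∧ ∃ u, o s (transition M h u) = z := by
    intro z hz
    induction hz using Submodule.span_induction with
    | mem z hz => exact Or.inr hz
    | zero => exact Or.inl rfl
    | add z z' _ _ hz hz' =>
      rcases hz with rfl | ⟨r, s, h, hr, u, rfl⟩
      · simpa using hz'
      rcases hz' with rfl | ⟨r', s', h', hr', u', rfl⟩
      · exact Or.inr ⟨r, s, h, hr, u, by simp⟩
      right
      have hmax : max r r' ∉ I := by
        rcases max_choice r r' with e | e <;> rw [e] <;> assumption
      refine ⟨max r r', max s s', ?_, hmax, transition M (le_max_left r r') u +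
        transition M (le_max_right r r') u', ?_⟩
      · exact max_le (h.trans (le_max_left s s')) (h'.trans (le_max_right s s'))
      · rw [map_add, map_add, transition_trans, transition_trans,
          ← ho s (max s s') (le_max_left s s'), ← ho s' (max s s') (le_max_right s s'),
          transition_trans, transition_trans]
    | smul c z _ hz =>
      rcases hz with rfl | ⟨r, s, h, hr, u, rfl⟩
      · simp
      · exact Or.inr ⟨r, s, h, hr, c • u, by simp⟩
  obtain ⟨a, ha⟩ := hne
  have hY : o ⟨a, ha⟩ (y a) ∉ N := by
    intro hmem
    rcases hN _ hmem with hz | ⟨r, s, h, hr, u, hu⟩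
    · obtain ⟨j, hj, hj0⟩ := Module.DirectLimit.of.zero_exact (f := f) hz
      exact h0 j j.2 ((hmap a j hj ha j.2).symm.trans hj0)
    · have hs : o s (transition M h u) = o (max s ⟨a, ha⟩)
          (transition M (h.trans (le_max_left s ⟨a, ha⟩)) u) := by
        rw [← ho s (max s ⟨a, ha⟩) (le_max_left s ⟨a, ha⟩), transition_trans]
      have ha' : o ⟨a, ha⟩ (y a) = o (max s ⟨a, ha⟩) (y (max s ⟨a, ha⟩ : I)) := by
        rw [← ho ⟨a, ha⟩ (max s ⟨a, ha⟩) (le_max_right s ⟨a, ha⟩), hmap _ _ _ ha (Subtype.mem _)]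
      rw [hs, ha'] at hu
      obtain ⟨j, hj, hj0⟩ := Module.DirectLimit.exists_eq_of_of_eq (f := f) hu
      refine hbirth r j (h.trans ((le_max_left s ⟨a, ha⟩).trans hj)) hr j.2 u ?_
      have e1 := transition_trans M (h.trans (le_max_left s ⟨a, ha⟩)) hj u
      have e2 := hmap _ _ hj (Subtype.mem (max s ⟨a, ha⟩)) j.2
      exact e1.symm.trans (hj0.trans e2)
  obtain ⟨F, hF, hFN⟩ := Submodule.exists_le_ker_of_notMem hY
  refine ⟨fun r => (F (o ⟨a, ha⟩ (y a)))⁻¹ • F.comp (o r), ?_, ?_, ?_⟩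
  · intro r s h x
    simp [ho r s h x]
  · intro r
    have : o r (y r) = o ⟨a, ha⟩ (y a) := by
      rw [← ho r (max r ⟨a, ha⟩) (le_max_left r ⟨a, ha⟩),
        ← ho ⟨a, ha⟩ (max r ⟨a, ha⟩) (le_max_right r ⟨a, ha⟩),
        hmap _ _ _ r.2 (Subtype.mem _), hmap _ _ _ ha (Subtype.mem _)]
    simp [this, hF]
  · intro r s h hr u
    have : F (o s (transition M h u)) = 0 :=
      hFN (Submodule.subset_span ⟨r, s, h, hr, u, rfl⟩)
    simp [this]

/-- A family that is compatible over `I`, dies after `I`, and at no parameter of `I` comes from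
before `I`, generates a direct summand isomorphic to the interval module of `I`. -/
theorem isBar_of_family (M : ℝ ⥤ ModuleCat.{u} k) {I : Set ℝ} (hI : I.OrdConnected)
    (hne : I.Nonempty) (y : ∀ r, M.obj r)
    (hmap : ∀ (r s : ℝ) (h : r ≤ s), r ∈ I → s ∈ I → transition M h (y r) = y s)
    (hdeath : ∀ (r s : ℝ) (h : r ≤ s), r ∈ I → s ∉ I → transition M h (y r) = 0)
    (h0 : ∀ s ∈ I, y s ≠ 0)
    (hbirth : ∀ (r s : ℝ) (h : r ≤ s), r ∉ I → s ∈ I → ∀ u, transition M h u ≠ y s) :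
    IsBar M I hI := by
  classical
  obtain ⟨φ, hφ, hφy, hφ0⟩ := exists_dual_family M hne y hmap h0 hbirth
  refine ⟨{
    i := {
      app := fun r => ModuleCat.ofHom
        { toFun := fun g => (if h : r ∈ I then g ⟨h⟩ else 0) • y r
          map_add' := fun g g' => by by_cases h : r ∈ I <;> simp [h, add_smul]
          map_smul' := fun c g => by by_cases h : r ∈ I <;> simp [h, mul_smul] }
      naturality := ?_ }
    r := {
      app := fun r => ModuleCat.ofHom
        { toFun := fun x h => φ ⟨r, h.down⟩ x
          map_add' := fun x x' => by funext h; simp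
          map_smul' := fun c x => by funext h; simp }
      naturality := ?_ }
    retract := ?_ }⟩
  · intro r s f
    refine ModuleCat.hom_ext (LinearMap.ext fun g => ?_)
    change (if h : s ∈ I then (if hr : r ∈ I then g ⟨hr⟩ else 0) else 0) • y s =
      transition M (leOfHom f) ((if h : r ∈ I then g ⟨h⟩ else 0) • y r)
    by_cases hr : r ∈ I
    · by_cases hs : s ∈ I
      · simp [hr, hs, hmap r s (leOfHom f) hr hs]
      · simp [hr, hs, hdeath r s (leOfHom f) hr hs]
    · simp [hr]
  · intro r s f
    refine ModuleCat.hom_ext (LinearMap.ext fun x => ?_)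
    funext hs
    change φ ⟨s, hs.down⟩ (transition M (leOfHom f) x) =
      if hr : r ∈ I then φ ⟨r, hr⟩ x else 0
    by_cases hr : r ∈ I
    · simpa [hr] using hφ ⟨r, hr⟩ ⟨s, hs.down⟩ (leOfHom f) x
    · simpa [hr] using hφ0 r ⟨s, hs.down⟩ (leOfHom f) hr x
  · refine NatTrans.ext (funext fun r => ModuleCat.hom_ext (LinearMap.ext fun g => ?_))
    funext hr
    change φ ⟨r, hr.down⟩ ((if h : r ∈ I then g ⟨h⟩ else 0) • y r) = g hr
    simp [hr.down, hφy ⟨r, hr.down⟩]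

/-- A family defined at all positive parameters, nonzero before `β` and zero after `β'`, gives a
bar born at `0` when the module vanishes at parameters `≤ 0`. -/
theorem isDiagramPoint_of_family (M : ℝ ⥤ ModuleCat.{u} k) {β β' : ℝ} (hβ : 0 < β)
    (hM : ∀ r ≤ 0, Subsingleton (M.obj r)) (x : ∀ r, M.obj r)
    (hmap : ∀ (r s : ℝ) (h : r ≤ s), 0 < r → transition M h (x r) = x s)
    (h0 : ∀ r, 0 < r → r < β → x r ≠ 0) (hdeath : ∀ r, β' < r → x r = 0) :
    ∃ d, β ≤ d ∧ d ≤ β' ∧ IsDiagramPoint M 0 d := by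
  set I : Set ℝ := {r | 0 < r ∧ x r ≠ 0} with hIdef
  have hanti : ∀ r s, 0 < r → r ≤ s → x s ≠ 0 → x r ≠ 0 := by
    intro r s hr hrs hs hr0
    exact hs (by rw [← hmap r s hrs hr, hr0, map_zero])
  have hIoo : Set.Ioo 0 β ⊆ I := fun r hr => ⟨hr.1, h0 r hr.1 hr.2⟩
  have hIβ : ∀ r ∈ I, r ≤ β' := fun r hr => not_lt.1 fun h => hr.2 (hdeath r h)
  have hbdd : BddAbove I := ⟨β', hIβ⟩
  have hne : I.Nonempty := ⟨β / 2, hIoo ⟨by linarith, by linarith⟩⟩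
  have hlub : IsLUB I (sSup I) := isLUB_csSup hne hbdd
  have hβd : β ≤ sSup I := (isLUB_Ioo hβ).2 fun r hr => hlub.1 (hIoo hr)
  have hI : I.OrdConnected :=
    ⟨fun r hr s hs t ht => ⟨hr.1.trans_le ht.1, hanti t s (hr.1.trans_le ht.1) ht.2 hs.2⟩⟩
  refine ⟨sSup I, hβd, csSup_le hne hIβ, hβ.trans_le hβd, I, hI,
    ⟨fun r hr => hr.1.le, fun c hc => (isGLB_Ioo hβ).2 fun r hr => hc (hIoo hr)⟩, hlub, ?_⟩
  refine isBar_of_family M hI hne x (fun r s h hr _ => hmap r s h hr.1) ?_ (fun s hs => hs.2) ?_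
  · intro r s h hr hs
    rw [hmap r s h hr.1]
    by_contra hs0
    exact hs ⟨hr.1.trans_le h, hs0⟩
  · intro r s h hr hs u hu
    rcases le_or_gt r 0 with hr0 | hr0
    · have := hM r hr0
      rw [Subsingleton.elim u 0, map_zero] at hu
      exact hs.2 hu.symm
    · exact hanti r s hr0 h hs.2 (by_contra fun h' => hr ⟨hr0, h'⟩)

/-- A class living at parameters `a` just above `δ` that is nonzero before `β` and zero after `β'`
forces a bar with birth in `[0, δ]` and death in `[β, β']`, when the module vanishes at parameters
`≤ 0` and every nonempty set of parameters has an element to which all smaller elements of the set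
map bijectively. The class itself need not span a bar: it is replaced by a class `y` with the
earliest birth, and then the earliest death, among those alive until `β` and dead after `β'`. -/
theorem isDiagramPoint_of_class (M : ℝ ⥤ ModuleCat.{u} k) {δ β β' : ℝ} (hδ : 0 ≤ δ) (hβ : δ < β)
    (hββ' : β ≤ β') (hM : ∀ r ≤ 0, Subsingleton (M.obj r))
    (hfin : ∀ J : Set ℝ, J.Nonempty →
      ∃ r₀ ∈ J, ∀ r ∈ J, ∀ h : r ≤ r₀, Function.Bijective (transition M h))
    (hx : ∀ a, δ < a → a < β → ∃ x : M.obj a,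
      (∀ r (h : a ≤ r), r < β → transition M h x ≠ 0) ∧
      ∀ r (h : a ≤ r), β' < r → transition M h x = 0) :
    ∃ b d, 0 ≤ b ∧ b ≤ δ ∧ β ≤ d ∧ d ≤ β' ∧ IsDiagramPoint M b d := by
  obtain ⟨a, hδa, haβ, hconst⟩ : ∃ a, δ < a ∧ a < β ∧
      ∀ r, δ < r → ∀ h : r ≤ a, Function.Surjective (transition M h) := by
    obtain ⟨r₀, hr₀, hb⟩ := hfin (Set.Ioo δ β) (Set.nonempty_Ioo.2 hβ)
    exact ⟨r₀, hr₀.1, hr₀.2, fun r hr h => (hb r ⟨hr, h.trans_lt hr₀.2⟩ h).2⟩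
  obtain ⟨x, hxne, hx0⟩ := hx a hδa haβ
  -- `Kpos z` says that `z` is dead after `β'`, and `Kneg z` that `z` is dead before `β`.
  let Kpos : M.obj a → Prop := fun z => ∀ s (h : a ≤ s), β' < s → transition M h z = 0
  let Kneg : M.obj a → Prop := fun z => ∃ s, ∃ h : a ≤ s, s < β ∧ transition M h z = 0
  have hKneg_pos : ∀ z, Kneg z → Kpos z := by
    rintro z ⟨s, h, hs, hz⟩ t ht hβt
    have hst : s ≤ t := hs.le.trans (hββ'.trans hβt.le)
    rw [← transition_trans M h hst, hz, map_zero]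
  have hKneg_add : ∀ z w, Kneg z → Kneg w → Kneg (z + w) := by
    rintro z w ⟨s, h, hs, hz⟩ ⟨t, h', ht, hw⟩
    refine ⟨max s t, h.trans (le_max_left s t), max_lt hs ht, ?_⟩
    rw [map_add, ← transition_trans M h (le_max_left s t),
      ← transition_trans M h' (le_max_right s t), hz, hw, map_zero, map_zero, add_zero]
  have hxneg : ¬ Kneg x := fun ⟨s, h, hs, hz⟩ => hxne s h hs hz
  -- By parameter `r ∈ J₁`, some element alive until `β` and dead after `β'` has been born.
  let J₁ : Set ℝ := {r | ∃ h : r ≤ a, ∃ u, Kpos (transition M h u) ∧ ¬ Kneg (transition M h u)}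
  have hJ₁δ : ∀ r, δ < r → r ≤ a → r ∈ J₁ := by
    intro r hr h
    obtain ⟨u, hu⟩ := hconst r hr h x
    exact ⟨h, u, hu ▸ hx0, hu ▸ hxneg⟩
  have haJ₁ : a ∈ J₁ := hJ₁δ a hδa le_rfl
  have hJ₁up : ∀ r s, r ∈ J₁ → r ≤ s → s ≤ a → s ∈ J₁ := by
    rintro r s ⟨h, u, hu⟩ hrs hsa
    exact ⟨hsa, transition M hrs u, by rwa [transition_trans]⟩
  have hJ₁pos : ∀ r ∈ J₁, 0 < r := by
    rintro r ⟨h, u, -, hu⟩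
    by_contra hr
    have := hM r (not_lt.1 hr)
    exact hu ⟨a, le_rfl, haβ, by rw [Subsingleton.elim u 0, map_zero, map_zero]⟩
  obtain ⟨b₀, hb₀, hbij⟩ := hfin J₁ ⟨a, haJ₁⟩
  have hb₀a : b₀ ≤ a := hb₀.1
  -- The image of `M b₀` in `M a` contains the images of all parameters outside `J₁`.
  have hBle : ∀ r (h : r ≤ a), r ∉ J₁ → ∀ u, ∃ w, transition M hb₀a w = transition M h u := by
    intro r h hr u
    have hrb : r ≤ b₀ := not_lt.1 fun hlt => hr (hJ₁up b₀ r hb₀ hlt.le h)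
    exact ⟨transition M hrb u, transition_trans M _ _ u⟩
  -- By parameter `s ∈ S`, some element of that image which is alive until `β` has died.
  let S : Set ℝ := {s | ∃ h : a ≤ s, ∃ w, transition M h (transition M hb₀a w) = 0 ∧
    ¬ Kneg (transition M hb₀a w)}
  have hSβ' : ∀ s, β' < s → s ∈ S := by
    intro s hs
    obtain ⟨h, w, hw, hw'⟩ := hb₀
    have has : a ≤ s := haβ.le.trans (hββ'.trans hs.le)
    exact ⟨has, w, hw s has hs, hw'⟩
  have hSup : ∀ s t, s ∈ S → s ≤ t → t ∈ S := by
    rintro s t ⟨h, w, hw, hw'⟩ hst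
    exact ⟨h.trans hst, w, by rw [← transition_trans M h hst, hw, map_zero], hw'⟩
  have hSβ : ∀ s ∈ S, β ≤ s := by
    rintro s ⟨h, w, hw, hw'⟩
    exact not_lt.1 fun hs => hw' ⟨s, h, hs, hw⟩
  obtain ⟨d₀, hd₀, hdbij⟩ := hfin S ⟨β' + 1, hSβ' _ (by linarith)⟩
  obtain ⟨had₀, w, hwd, hwneg⟩ := hd₀
  have hd₀S : d₀ ∈ S := ⟨had₀, w, hwd, hwneg⟩
  set y := transition M hb₀a w with hy
  have hyS : ∀ s (h : a ≤ s), s ∈ S → transition M h y = 0 := by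
    intro s h hs
    rcases le_total s d₀ with hsd | hds
    · apply (hdbij s hs hsd).1
      rw [transition_trans, map_zero]
      exact hwd
    · rw [← transition_trans M had₀ hds, hwd, map_zero]
  have hypos : Kpos y := fun s h hs => hyS s h (hSβ' s hs)
  -- The key step: at no parameter of the interval does `y` come from before `J₁`.
  have hkey : ∀ r (h : r ≤ a) s (h' : a ≤ s), r ∉ J₁ → s ∉ S → ∀ u,
      transition M h' (transition M h u) ≠ transition M h' y := by
    intro r h s h' hr hs u hu
    obtain ⟨v, hv⟩ := hBle r h hr u
    have hneg1 : Kneg (y - transition M h u) := by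
      by_contra hcon
      refine hs ⟨h', w - v, ?_, ?_⟩
      · rw [map_sub, map_sub, hv, ← hy, hu, sub_self]
      · rwa [map_sub, hv, ← hy]
    have hpos2 : Kpos (transition M h u) := by
      intro t ht hβt
      have e1 := hKneg_pos _ hneg1 t ht hβt
      rw [map_sub, hypos t ht hβt, zero_sub, neg_eq_zero] at e1
      exact e1
    have hneg2 : Kneg (transition M h u) := by
      by_contra hcon
      exact hr ⟨h, u, hpos2, hcon⟩
    exact hwneg (by simpa using hKneg_add _ _ hneg1 hneg2)
  set I : Set ℝ := {r | (r ∈ J₁ ∨ a ≤ r) ∧ r ∉ S} with hIdef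
  have haS : a ∉ S := fun h => (hSβ a h).not_gt haβ
  have hJ₁S : ∀ r, r ≤ a → r ∉ S := fun r hr h => haS (hSup r a h hr)
  have haI : a ∈ I := ⟨Or.inr le_rfl, haS⟩
  have hI : I.OrdConnected := by
    refine ⟨fun r hr s hs t ht => ⟨?_, fun h => hs.2 (hSup t s h ht.2)⟩⟩
    rcases le_total a t with hat | hta
    · exact Or.inr hat
    · rcases hr.1 with hr1 | hr1
      · exact Or.inl (hJ₁up r t hr1 ht.1 hta)
      · exact Or.inr (hr1.trans ht.1)
  have hIb : ∀ r, δ < r → r ≤ a → r ∈ I := fun r hr h => ⟨Or.inl (hJ₁δ r hr h), hJ₁S r h⟩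
  have hIpos : ∀ r ∈ I, 0 < r := by
    rintro r ⟨hr | hr, -⟩
    · exact hJ₁pos r hr
    · exact (hδ.trans_lt hδa).trans_le hr
  have hIβ : ∀ r, a ≤ r → r < β → r ∈ I := fun r h hr =>
    ⟨Or.inr h, fun hs => (hSβ r hs).not_gt hr⟩
  have hIβ' : ∀ r ∈ I, r ≤ β' := fun r hr => not_lt.1 fun h => hr.2 (hSβ' r h)
  have hglb : IsGLB I (sInf I) := isGLB_csInf ⟨a, haI⟩ ⟨0, fun r hr => (hIpos r hr).le⟩
  have hlub : IsLUB I (sSup I) := isLUB_csSup ⟨a, haI⟩ ⟨β', hIβ'⟩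
  have hbδ : sInf I ≤ δ := (isGLB_Ioc hδa).2 fun r hr => hglb.1 (hIb r hr.1 hr.2)
  have hβd : β ≤ sSup I := (isLUB_Ico haβ).2 fun r hr => hlub.1 (hIβ r hr.1 hr.2)
  refine ⟨sInf I, sSup I, le_csInf ⟨a, haI⟩ fun r hr => (hIpos r hr).le, hbδ, hβd,
    csSup_le ⟨a, haI⟩ hIβ', hbδ.trans_lt (hβ.trans_le hβd), I, hI, hglb, hlub, ?_⟩
  -- Lift `y` compatibly to all of `I`; below `b₀` the structure maps are bijective.
  have hlift : ∀ r, ∃ z : M.obj r, r ∈ I → (∀ h : b₀ ≤ r, transition M h w = z) ∧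
      ∀ h : r ≤ b₀, transition M h z = w := by
    intro r
    rcases le_total b₀ r with h | h
    · refine ⟨transition M h w, fun _ => ⟨fun _ => rfl, fun h' => ?_⟩⟩
      rw [transition_trans, transition_refl]
    · by_cases hr : r ∈ I
      · have hrJ : r ∈ J₁ := by
          rcases hr.1 with hr1 | hr1
          · exact hr1
          · exact hJ₁up b₀ r hb₀ (hb₀a.trans hr1) (h.trans hb₀a)
        obtain ⟨z, hz⟩ := (hbij r hrJ h).2 w
        refine ⟨z, fun _ => ⟨fun h' => ?_, fun _ => hz⟩⟩
        rw [← hz, transition_trans, transition_refl]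
      · exact ⟨0, fun h => absurd h hr⟩
  choose f hf using hlift
  have hfmap : ∀ (r s : ℝ) (h : r ≤ s), r ∈ I → s ∈ I → transition M h (f r) = f s := by
    intro r s h hr hs
    rcases le_total b₀ s with hbs | hsb
    · rw [← (hf s hs).1 hbs]
      rcases le_total b₀ r with hbr | hrb
      · rw [← (hf r hr).1 hbr, transition_trans]
      · rw [← (hf r hr).2 hrb, transition_trans]
    · have hsJ : s ∈ J₁ := by
        rcases hs.1 with hs1 | hs1
        · exact hs1
        · exact hJ₁up b₀ s hb₀ (hb₀a.trans hs1) (hsb.trans hb₀a)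
      apply (hbij s hsJ hsb).1
      rw [transition_trans, (hf s hs).2 hsb, (hf r hr).2 (h.trans hsb)]
  have hfa : f a = y := ((hf a haI).1 hb₀a).symm
  have hbirth : ∀ (r s : ℝ) (h : r ≤ s), r ≤ a → r ∉ J₁ → s ∈ I →
      ∀ u, transition M h u ≠ f s := by
    intro r s h hra hr hs u hu
    rcases le_total a s with has | hsa
    · refine hkey r hra s has hr hs.2 u ?_
      rw [transition_trans, hu, ← hfa, hfmap a s has haI hs]
    · refine hkey r hra a le_rfl hr haS u ?_
      rw [transition_refl, transition_refl, ← hfa, ← hfmap s a hsa hs haI, ← hu,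
        transition_trans]
  refine isBar_of_family M hI ⟨a, haI⟩ f hfmap ?_ ?_ ?_
  · intro r s h hr hs
    have hsS : s ∈ S := by
      by_contra hsS
      apply hs
      refine ⟨?_, hsS⟩
      rcases hr.1 with hr1 | hr1
      · rcases le_total a s with has | hsa
        · exact Or.inr has
        · exact Or.inl (hJ₁up r s hr1 h hsa)
      · exact Or.inr (hr1.trans h)
    have has : a ≤ s := haβ.le.trans (hSβ s hsS)
    rcases le_total a r with har | hra
    · rw [← hfmap a r har haI hr, transition_trans, hfa]
      exact hyS s has hsS
    · rw [← transition_trans M hra has, hfmap r a hra hr haI, hfa]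
      exact hyS s has hsS
  · intro s hs hs0
    have h0J : (0 : ℝ) ∉ J₁ := fun h => lt_irrefl _ (hJ₁pos 0 h)
    refine hbirth 0 s (hIpos s hs).le (hδ.trans hδa.le) h0J hs 0 ?_
    rw [map_zero, hs0]
  · intro r s h hr hs u
    have hra : r ≤ a := by
      by_contra hra
      exact hr ⟨Or.inr (not_le.1 hra).le, fun hrS => hs.2 (hSup r s hrS h)⟩
    exact hbirth r s h hra (fun hrJ => hr ⟨Or.inl hrJ, hJ₁S r hra⟩) hs u

end Bars

/-! ### The winding functional -/

section Winding

/-- The contribution of an edge to the winding number about the origin, given the heights `a`, `b`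
of its end points above an oriented line through the origin and their determinant `D`: the sign of
the crossing of the positive half of that line, where height `0` counts as above. -/
def crossingSign (a b D : ℝ) : ℤ :=
  if a < 0 then (if 0 ≤ b ∧ 0 < D then 1 else 0) else (if b < 0 ∧ D < 0 then -1 else 0)

/-- The signed crossings of the positive half-line add up around a triangle, when the origin is
not a nontrivial convex combination of the vertices; `D₁`, `D₂`, `D₃` are the determinants of the
three edges, which are also the barycentric coordinates of the origin up to scaling. -/
theorem crossingSign_add {a b c D₁ D₂ D₃ : ℝ} (h : D₁ * a + D₂ * b + D₃ * c = 0)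
    (hpos : 0 ≤ D₁ → 0 ≤ D₂ → 0 ≤ D₃ → D₁ = 0 ∧ D₂ = 0 ∧ D₃ = 0)
    (hneg : D₁ ≤ 0 → D₂ ≤ 0 → D₃ ≤ 0 → D₁ = 0 ∧ D₂ = 0 ∧ D₃ = 0) :
    crossingSign a b D₃ + crossingSign b c D₁ = crossingSign a c (-D₂) := by
  unfold crossingSign
  -- When the first vertex is alone on its side of the line, its two edges cross the line on the
  -- same half.
  have key : ∀ {a b c D₁ D₂ D₃ : ℝ}, D₁ * a + D₂ * b + D₃ * c = 0 →
      (a < 0 ∧ 0 ≤ b ∧ 0 ≤ c ∨ 0 ≤ a ∧ b < 0 ∧ c < 0) →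
      (0 ≤ D₁ → 0 ≤ D₂ → 0 ≤ D₃ → D₁ = 0 ∧ D₂ = 0 ∧ D₃ = 0) →
      (D₁ ≤ 0 → D₂ ≤ 0 → D₃ ≤ 0 → D₁ = 0 ∧ D₂ = 0 ∧ D₃ = 0) →
      (0 < D₂ → 0 ≤ D₃ → False) ∧ (D₂ < 0 → D₃ ≤ 0 → False) ∧
      (0 < D₃ → 0 ≤ D₂ → False) ∧ (D₃ < 0 → D₂ ≤ 0 → False) := by
    intro a b c D₁ D₂ D₃ h hs hpos hneg
    have hp : 0 ≤ D₂ → 0 ≤ D₃ → D₂ = 0 ∧ D₃ = 0 := by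
      intro h2 h3
      by_contra hcon
      have h1 : ¬ 0 ≤ D₁ := fun h1 => hcon ⟨(hpos h1 h2 h3).2.1, (hpos h1 h2 h3).2.2⟩
      rcases hs with ⟨ha, hb, hc⟩ | ⟨ha, hb, hc⟩
      · nlinarith [mul_pos_of_neg_of_neg (not_le.1 h1) ha, mul_nonneg h2 hb, mul_nonneg h3 hc]
      · have e1 := mul_nonneg_of_nonpos_of_nonpos (not_le.1 h1).le (neg_nonpos.2 ha)
        have e2 := mul_nonneg h2 (neg_pos.2 hb).le
        have e3 := mul_nonneg h3 (neg_pos.2 hc).le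
        have z2 : D₂ * -b = 0 := by linarith
        have z3 : D₃ * -c = 0 := by linarith
        exact hcon ⟨(mul_eq_zero.1 z2).resolve_right (by linarith),
          (mul_eq_zero.1 z3).resolve_right (by linarith)⟩
    have hn : D₂ ≤ 0 → D₃ ≤ 0 → D₂ = 0 ∧ D₃ = 0 := by
      intro h2 h3
      by_contra hcon
      have h1 : ¬ D₁ ≤ 0 := fun h1 => hcon ⟨(hneg h1 h2 h3).2.1, (hneg h1 h2 h3).2.2⟩
      rcases hs with ⟨ha, hb, hc⟩ | ⟨ha, hb, hc⟩
      · nlinarith [mul_neg_of_pos_of_neg (not_le.1 h1) ha, mul_nonneg (neg_nonneg.2 h2) hb,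
          mul_nonneg (neg_nonneg.2 h3) hc]
      · have e1 := mul_nonneg (not_le.1 h1).le ha
        have e2 := mul_nonneg (neg_nonneg.2 h2) (neg_pos.2 hb).le
        have e3 := mul_nonneg (neg_nonneg.2 h3) (neg_pos.2 hc).le
        have z2 : D₂ * -b = 0 := by linarith
        have z3 : D₃ * -c = 0 := by linarith
        exact hcon ⟨(mul_eq_zero.1 z2).resolve_right (by linarith),
          (mul_eq_zero.1 z3).resolve_right (by linarith)⟩
    exact ⟨fun x y => x.ne' (hp x.le y).1, fun x y => x.ne (hn x.le y).1,
      fun x y => x.ne' (hp y x.le).2, fun x y => x.ne (hn y x.le).2⟩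
  -- Permute the vertices cyclically so that the one alone on its side comes first.
  rcases lt_or_ge a 0 with ha | ha <;> rcases lt_or_ge b 0 with hb | hb <;>
    rcases lt_or_ge c 0 with hc | hc <;>
    simp only [ha, hb, hc, not_lt.2, not_le.2, if_true, if_false, true_and, false_and]
  · simp
  · obtain ⟨k1, k2, k3, k4⟩ := key (a := c) (b := a) (c := b) (D₁ := D₃) (D₂ := D₁) (D₃ := D₂)
      (by linarith) (Or.inr ⟨hc, ha, hb⟩) (fun x y z => by tauto) (fun x y z => by tauto)
    split_ifs <;> grind
  · obtain ⟨k1, k2, k3, k4⟩ := key (a := b) (b := c) (c := a) (D₁ := D₂) (D₂ := D₃) (D₃ := D₁)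
      (by linarith) (Or.inr ⟨hb, hc, ha⟩) (fun x y z => by tauto) (fun x y z => by tauto)
    split_ifs <;> grind
  · obtain ⟨k1, k2, k3, k4⟩ := key h (Or.inl ⟨ha, hb, hc⟩) hpos hneg
    split_ifs <;> grind
  · obtain ⟨k1, k2, k3, k4⟩ := key h (Or.inr ⟨ha, hb, hc⟩) hpos hneg
    split_ifs <;> grind
  · obtain ⟨k1, k2, k3, k4⟩ := key (a := b) (b := c) (c := a) (D₁ := D₂) (D₂ := D₃) (D₃ := D₁)
      (by linarith) (Or.inl ⟨hb, hc, ha⟩) (fun x y z => by tauto) (fun x y z => by tauto)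
    split_ifs <;> grind
  · obtain ⟨k1, k2, k3, k4⟩ := key (a := c) (b := a) (c := b) (D₁ := D₃) (D₂ := D₁) (D₃ := D₂)
      (by linarith) (Or.inl ⟨hc, ha, hb⟩) (fun x y z => by tauto) (fun x y z => by tauto)
    split_ifs <;> grind
  · simp

/-- The determinant of two plane vectors. -/
def planeDet (p q : EuclideanSpace ℝ (Fin 2)) : ℝ := p 0 * q 1 - p 1 * q 0

/-- The signed height of `p` above the line through the origin at angle `θ`. -/
def height (θ : ℝ) (p : EuclideanSpace ℝ (Fin 2)) : ℝ := p 1 * Real.cos θ - p 0 * Real.sin θ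

/-- The signed number of crossings of the half-line at angle `θ` by the segment from `p` to `q`. -/
def crossing (θ : ℝ) (p q : EuclideanSpace ℝ (Fin 2)) : ℤ :=
  crossingSign (height θ p) (height θ q) (planeDet p q)

/-- No nontrivial nonnegative combination of three vertices of a face of `K` vanishes. -/
def AvoidsOrigin (K : PreAbstractSimplicialComplex (EuclideanSpace ℝ (Fin 2))) : Prop :=
  ∀ s ∈ K, ∀ p ∈ s, ∀ q ∈ s, ∀ r ∈ s, ∀ a b c : ℝ, 0 ≤ a → 0 ≤ b → 0 ≤ c →
    a • p + b • q + c • r = 0 → a = 0 ∧ b = 0 ∧ c = 0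

theorem crossing_add {K : PreAbstractSimplicialComplex (EuclideanSpace ℝ (Fin 2))}
    (hK : AvoidsOrigin K) (θ : ℝ) {s : Finset (EuclideanSpace ℝ (Fin 2))} (hs : s ∈ K)
    {p q r : EuclideanSpace ℝ (Fin 2)} (hp : p ∈ s) (hq : q ∈ s) (hr : r ∈ s) :
    crossing θ p q + crossing θ q r = crossing θ p r := by
  have hzero : planeDet q r • p + planeDet r p • q + planeDet p q • r = 0 := by
    ext i
    fin_cases i <;> simp [planeDet] <;> ring
  have h := crossingSign_add (a := height θ p) (b := height θ q) (c := height θ r)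
    (D₁ := planeDet q r) (D₂ := planeDet r p) (D₃ := planeDet p q)
    (by simp only [planeDet, height]; ring)
    (fun h1 h2 h3 => hK s hs p hp q hq r hr _ _ _ h1 h2 h3 hzero)
    (fun h1 h2 h3 => by
      have := hK s hs p hp q hq r hr _ _ _ (neg_nonneg.2 h1) (neg_nonneg.2 h2) (neg_nonneg.2 h3)
        (by rw [neg_smul, neg_smul, neg_smul, ← neg_add, ← neg_add, hzero, neg_zero])
      simpa using this)
  have hd : planeDet p r = -planeDet r p := by simp only [planeDet]; ring
  rw [crossing, crossing, crossing, hd, h]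

variable (k : Type*) [Field k]

/-- The linear functional on `1`-chains that counts crossings of the half-line at angle `θ`. -/
def winding (θ : ℝ) : ((Fin 2 → EuclideanSpace ℝ (Fin 2)) →₀ k) →ₗ[k] k :=
  Finsupp.linearCombination k fun σ => ((crossing θ (σ 0) (σ 1) : ℤ) : k)

theorem winding_edge (θ : ℝ) (p q : EuclideanSpace ℝ (Fin 2)) :
    winding k θ (edge k p q) = (crossing θ p q : ℤ) := by
  simp [winding, edge]

theorem winding_boundaries {K : PreAbstractSimplicialComplex (EuclideanSpace ℝ (Fin 2))}
    (hK : AvoidsOrigin K) (θ : ℝ) {z : (Fin 2 → EuclideanSpace ℝ (Fin 2)) →₀ k}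
    (hz : z ∈ boundaries k K 1) : winding k θ z = 0 := by
  suffices h : chains k K 2 ≤ LinearMap.ker ((winding k θ).comp (boundary k _ 1)) by
    obtain ⟨w, hw, rfl⟩ := hz
    exact h hw
  unfold chains
  rw [Finsupp.supported_eq_span_single, Submodule.span_le]
  rintro _ ⟨σ, ⟨s, hs, hσ⟩, rfl⟩
  have := crossing_add hK θ hs (hσ 0) (hσ 1) (hσ 2)
  rw [SetLike.mem_coe, LinearMap.mem_ker, LinearMap.comp_apply, boundary_triple, map_add, map_sub,
    winding_edge, winding_edge, winding_edge, ← this]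
  push_cast
  ring

end Winding

/-! ### Faces away from the origin -/

section Origin

theorem norm_sq_plane (p : EuclideanSpace ℝ (Fin 2)) : ‖p‖ ^ 2 = p 0 ^ 2 + p 1 ^ 2 := by
  rw [EuclideanSpace.real_norm_sq_eq, Fin.sum_univ_two]

theorem dist_sq_plane (p q : EuclideanSpace ℝ (Fin 2)) :
    dist p q ^ 2 = (p 0 - q 0) ^ 2 + (p 1 - q 1) ^ 2 := by
  rw [dist_eq_norm, norm_sq_plane]
  rfl

theorem avoidsOrigin_cech {P : Set (EuclideanSpace ℝ (Fin 2))} {β r : ℝ}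
    (hP : ∀ p ∈ P, β ≤ ‖p‖) (hr : r < β) : AvoidsOrigin (cech P r) := by
  rintro s ⟨-, hsP, c, hc⟩ p hp q hq u hu x y z hx hy hz h
  have hr0 : 0 ≤ r := dist_nonneg.trans (hc p hp)
  have hn : ∀ v ∈ s, β ^ 2 - r ^ 2 + (c 0 ^ 2 + c 1 ^ 2) ≤ 2 * (v 0 * c 0 + v 1 * c 1) := by
    intro v hv
    have h1 : dist v c ^ 2 ≤ r ^ 2 := pow_le_pow_left₀ dist_nonneg (hc v hv) 2
    have h2 : β ^ 2 ≤ ‖v‖ ^ 2 := pow_le_pow_left₀ (hr0.trans hr.le) (hP v (hsP hv)) 2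
    rw [dist_sq_plane] at h1
    rw [norm_sq_plane] at h2
    linarith
  have h0 : x * p 0 + y * q 0 + z * u 0 = 0 := by simpa using congrArg (fun v => v 0) h
  have h1 : x * p 1 + y * q 1 + z * u 1 = 0 := by simpa using congrArg (fun v => v 1) h
  have hpos : 0 < β ^ 2 - r ^ 2 + (c 0 ^ 2 + c 1 ^ 2) := by
    nlinarith [sq_nonneg (c 0), sq_nonneg (c 1)]
  have hsum : (x + y + z) * (β ^ 2 - r ^ 2 + (c 0 ^ 2 + c 1 ^ 2)) ≤ 0 := by
    have e1 := mul_le_mul_of_nonneg_left (hn p hp) hx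
    have e2 := mul_le_mul_of_nonneg_left (hn q hq) hy
    have e3 := mul_le_mul_of_nonneg_left (hn u hu) hz
    have e4 : x * (2 * (p 0 * c 0 + p 1 * c 1)) + y * (2 * (q 0 * c 0 + q 1 * c 1)) +
        z * (2 * (u 0 * c 0 + u 1 * c 1)) = 0 := by
      linear_combination (2 * c 0) * h0 + (2 * c 1) * h1
    linarith
  have : x + y + z ≤ 0 := by
    by_contra hcon
    exact absurd hsum (not_le.2 (mul_pos (not_le.1 hcon) hpos))
  exact ⟨by linarith, by linarith, by linarith⟩

/-- Three points outside the disc of radius `β` whose triangle contains the origin subtend an angle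
of at least `2π/3`, so two of them are at distance at least `√3 β`. -/
theorem avoidsOrigin_rips {P : Set (EuclideanSpace ℝ (Fin 2))} {β r : ℝ} (hβ : 0 ≤ β)
    (hP : ∀ p ∈ P, β ≤ ‖p‖) (hr : r < √3 / 2 * β) : AvoidsOrigin (rips P r) := by
  rintro s ⟨-, hsP, hd⟩ p hp q hq u hu x y z hx hy hz h
  have hr0 : 0 ≤ 2 * r := dist_nonneg.trans (hd p hp p hp)
  have h3 : √3 ^ 2 = 3 := Real.sq_sqrt (by norm_num)
  have hrβ : 4 * r ^ 2 < 3 * β ^ 2 := by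
    have := pow_lt_pow_left₀ hr (by linarith) (two_ne_zero)
    rw [mul_pow, div_pow, h3] at this
    linarith
  have hn : ∀ v ∈ s, β ^ 2 ≤ v 0 ^ 2 + v 1 ^ 2 := fun v hv => by
    rw [← norm_sq_plane]
    exact pow_le_pow_left₀ hβ (hP v (hsP hv)) 2
  have hin : ∀ v ∈ s, ∀ w ∈ s,
      2 * β ^ 2 - 4 * r ^ 2 ≤ 2 * (v 0 * w 0 + v 1 * w 1) := by
    intro v hv w hw
    have h1 : dist v w ^ 2 ≤ (2 * r) ^ 2 := pow_le_pow_left₀ dist_nonneg (hd v hv w hw) 2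
    rw [dist_sq_plane] at h1
    have h2 := hn v hv
    have h3 := hn w hw
    linarith
  have h0 : x * p 0 + y * q 0 + z * u 0 = 0 := by simpa using congrArg (fun v => v 0) h
  have h1 : x * p 1 + y * q 1 + z * u 1 = 0 := by simpa using congrArg (fun v => v 1) h
  -- Expand the square of the norm of the vanishing combination.
  have hsq : x ^ 2 * (p 0 ^ 2 + p 1 ^ 2) + y ^ 2 * (q 0 ^ 2 + q 1 ^ 2) +
      z ^ 2 * (u 0 ^ 2 + u 1 ^ 2) + x * y * (2 * (p 0 * q 0 + p 1 * q 1)) +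
      y * z * (2 * (q 0 * u 0 + q 1 * u 1)) + x * z * (2 * (p 0 * u 0 + p 1 * u 1)) = 0 := by
    linear_combination (x * p 0 + y * q 0 + z * u 0) * h0 + (x * p 1 + y * q 1 + z * u 1) * h1
  have e1 := mul_le_mul_of_nonneg_left (hn p hp) (sq_nonneg x)
  have e2 := mul_le_mul_of_nonneg_left (hn q hq) (sq_nonneg y)
  have e3 := mul_le_mul_of_nonneg_left (hn u hu) (sq_nonneg z)
  have e4 := mul_le_mul_of_nonneg_left (hin p hp q hq) (mul_nonneg hx hy)
  have e5 := mul_le_mul_of_nonneg_left (hin q hq u hu) (mul_nonneg hy hz)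
  have e6 := mul_le_mul_of_nonneg_left (hin p hp u hu) (mul_nonneg hx hz)
  have hβ2 : 0 < β ^ 2 := by nlinarith [sq_nonneg r]
  have hS : 0 ≤ x * y + y * z + x * z := by positivity
  have hQ : 0 ≤ x ^ 2 + y ^ 2 + z ^ 2 - (x * y + y * z + x * z) := by
    nlinarith [sq_nonneg (x - y), sq_nonneg (y - z), sq_nonneg (x - z)]
  have hmain : β ^ 2 * (x ^ 2 + y ^ 2 + z ^ 2 - (x * y + y * z + x * z)) +
      (3 * β ^ 2 - 4 * r ^ 2) * (x * y + y * z + x * z) ≤ 0 := by linarith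
  have t1 := mul_nonneg hβ2.le hQ
  have t2 := mul_nonneg (sub_pos.2 hrβ).le hS
  have s1 := (mul_eq_zero.1 (le_antisymm (by linarith) t1)).resolve_left hβ2.ne'
  have s2 := (mul_eq_zero.1 (le_antisymm (by linarith) t2)).resolve_left (sub_pos.2 hrβ).ne'
  have hsum : x ^ 2 + y ^ 2 + z ^ 2 = 0 := by linarith
  have := sq_nonneg x
  have := sq_nonneg y
  have := sq_nonneg z
  exact ⟨pow_eq_zero_iff (two_ne_zero) |>.1 (by linarith),
    pow_eq_zero_iff (two_ne_zero) |>.1 (by linarith),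
    pow_eq_zero_iff (two_ne_zero) |>.1 (by linarith)⟩

end Origin

/-! ### The parametrized ellipse -/

section Curve

/-- The parametrization of `ellipse a b θ`. -/
def ellipseCurve (a b θ t : ℝ) : EuclideanSpace ℝ (Fin 2) :=
  !₂[a * Real.cos t * Real.cos θ - b * Real.sin t * Real.sin θ,
    a * Real.cos t * Real.sin θ + b * Real.sin t * Real.cos θ]

theorem ellipseCurve_mem (a b θ t : ℝ) : ellipseCurve a b θ t ∈ ellipse a b θ := ⟨t, rfl⟩

theorem ellipseCurve_pi (a b θ : ℝ) :
    ellipseCurve a b θ Real.pi = ellipseCurve a b θ (-Real.pi) := by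
  simp [ellipseCurve]

/-- Turning an ellipse by a right angle interchanges its radii. -/
theorem ellipse_add_pi_div_two (a b θ : ℝ) :
    ellipse b a (θ + Real.pi / 2) ⊆ ellipse a b θ := by
  rintro _ ⟨t, rfl⟩
  refine ⟨t + Real.pi / 2, ?_⟩
  ext i
  fin_cases i <;>
    simp [Real.sin_add_pi_div_two, Real.cos_add_pi_div_two] <;> ring

theorem norm_sq_ellipseCurve (a b θ t : ℝ) :
    ‖ellipseCurve a b θ t‖ ^ 2 = (a * Real.cos t) ^ 2 + (b * Real.sin t) ^ 2 := by
  rw [norm_sq_plane]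
  simp only [ellipseCurve, PiLp.toLp_apply, Matrix.cons_val_zero, Matrix.cons_val_one]
  linear_combination ((a * Real.cos t) ^ 2 + (b * Real.sin t) ^ 2) * Real.sin_sq_add_cos_sq θ

theorem le_norm_of_mem_ellipse {a b c θ : ℝ} (hc : 0 ≤ c) (ha : c ≤ a) (hb : c ≤ b)
    {p : EuclideanSpace ℝ (Fin 2)} (hp : p ∈ ellipse a b θ) : c ≤ ‖p‖ := by
  obtain ⟨t, rfl⟩ := hp
  refine le_of_sq_le_sq ?_ (norm_nonneg _)
  have h := norm_sq_ellipseCurve a b θ t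
  rw [ellipseCurve] at h
  rw [h]
  have h1 : c ^ 2 ≤ a ^ 2 := pow_le_pow_left₀ hc ha 2
  have h2 : c ^ 2 ≤ b ^ 2 := pow_le_pow_left₀ hc hb 2
  nlinarith [Real.sin_sq_add_cos_sq t, mul_le_mul_of_nonneg_right h1 (sq_nonneg (Real.cos t)),
    mul_le_mul_of_nonneg_right h2 (sq_nonneg (Real.sin t))]

theorem dist_ellipseCurve_le {a b : ℝ} (hb : 0 ≤ b) (hab : b ≤ a) (θ s t : ℝ) :
    dist (ellipseCurve a b θ s) (ellipseCurve a b θ t) ≤ 2 * a * |s - t| := by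
  refine le_of_sq_le_sq ?_ (by have := hb.trans hab; positivity)
  have hc : (Real.cos s - Real.cos t) ^ 2 ≤ |s - t| ^ 2 :=
    sq_le_sq.2 (by rw [abs_abs]; exact Real.abs_cos_sub_cos_le s t)
  have hs : (Real.sin s - Real.sin t) ^ 2 ≤ |s - t| ^ 2 :=
    sq_le_sq.2 (by rw [abs_abs]; exact Real.abs_sin_sub_sin_le s t)
  have hba : b ^ 2 ≤ a ^ 2 := pow_le_pow_left₀ hb hab 2
  have h : dist (ellipseCurve a b θ s) (ellipseCurve a b θ t) ^ 2 =
      a ^ 2 * (Real.cos s - Real.cos t) ^ 2 + b ^ 2 * (Real.sin s - Real.sin t) ^ 2 := by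
    rw [dist_sq_plane]
    simp only [ellipseCurve, PiLp.toLp_apply, Matrix.cons_val_zero, Matrix.cons_val_one]
    linear_combination (a ^ 2 * (Real.cos s - Real.cos t) ^ 2 +
      b ^ 2 * (Real.sin s - Real.sin t) ^ 2) * Real.sin_sq_add_cos_sq θ
  rw [h, mul_pow, mul_pow]
  have e1 := mul_le_mul_of_nonneg_left hc (sq_nonneg a)
  have e2 := mul_le_mul hba hs (sq_nonneg _) (sq_nonneg a)
  have e3 : 0 ≤ a ^ 2 * |s - t| ^ 2 := by positivity
  linarith

/-- The point `(a cos t, 0)` of the first axis, which is within the second radius of the points with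
parameters `t` and `-t`. -/
def axisPoint (a θ t : ℝ) : EuclideanSpace ℝ (Fin 2) := ellipseCurve a 0 θ t

theorem dist_axisPoint_le (a θ t : ℝ) {b : ℝ} (hb : 0 ≤ b) :
    dist (ellipseCurve a b θ t) (axisPoint a θ t) ≤ b := by
  refine le_of_sq_le_sq ?_ hb
  rw [dist_sq_plane]
  have : (ellipseCurve a b θ t 0 - axisPoint a θ t 0) ^ 2 +
      (ellipseCurve a b θ t 1 - axisPoint a θ t 1) ^ 2 = b ^ 2 * Real.sin t ^ 2 := by
    simp only [axisPoint, ellipseCurve, PiLp.toLp_apply, Matrix.cons_val_zero, Matrix.cons_val_one]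
    linear_combination (b ^ 2 * Real.sin t ^ 2) * Real.sin_sq_add_cos_sq θ
  rw [this]
  exact mul_le_of_le_one_right (sq_nonneg b) (Real.sin_sq_le_one t)

theorem dist_axisPoint_neg_le (a θ t : ℝ) {b : ℝ} (hb : 0 ≤ b) :
    dist (ellipseCurve a b θ (-t)) (axisPoint a θ t) ≤ b := by
  have : axisPoint a θ t = axisPoint a θ (-t) := by simp [axisPoint, ellipseCurve]
  rw [this]
  exact dist_axisPoint_le a θ (-t) hb

theorem height_ellipseCurve (a b θ t : ℝ) : height θ (ellipseCurve a b θ t) = b * Real.sin t := by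
  simp only [height, ellipseCurve, PiLp.toLp_apply, Matrix.cons_val_zero, Matrix.cons_val_one]
  linear_combination (b * Real.sin t) * Real.sin_sq_add_cos_sq θ

theorem planeDet_ellipseCurve (a b θ s t : ℝ) :
    planeDet (ellipseCurve a b θ s) (ellipseCurve a b θ t) = a * b * Real.sin (t - s) := by
  simp only [planeDet, ellipseCurve, PiLp.toLp_apply, Matrix.cons_val_zero, Matrix.cons_val_one,
    Real.sin_sub]
  linear_combination (a * b * (Real.sin t * Real.cos s - Real.cos t * Real.sin s)) *
    Real.sin_sq_add_cos_sq θ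

/-- An inscribed polygon winds once around the origin: its only counted crossing is at the vertex
with parameter `0`. -/
theorem winding_loopChain (k : Type*) [Field k] {a b : ℝ} (ha : 0 < a) (hb : 0 < b) (θ : ℝ) {N : ℕ}
    (hN : 2 ≤ N) : winding k θ (loopChain k (ellipseCurve a b θ) N) = 1 := by
  have hpi := Real.pi_pos
  have hN0 : (0 : ℝ) < N := by exact_mod_cast (by omega : 0 < N)
  have hstep : ∀ j : ℕ, Real.pi * (j + 1 : ℕ) / N - Real.pi * j / N = Real.pi / N := by
    intro j; push_cast; field_simp; ring
  have hsmall : Real.pi / N < Real.pi := div_lt_self hpi (by exact_mod_cast (by omega : 1 < N))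
  have hsinN : 0 < Real.sin (Real.pi / N) := Real.sin_pos_of_pos_of_lt_pi (by positivity) hsmall
  have hle : ∀ j : ℕ, j ≤ N → Real.pi * j / N ≤ Real.pi := by
    intro j hj
    rw [div_le_iff₀ hN0]
    exact mul_le_mul_of_nonneg_left (by exact_mod_cast hj) hpi.le
  have hlt : ∀ j : ℕ, j < N → Real.pi * j / N < Real.pi := by
    intro j hj
    rw [div_lt_iff₀ hN0]
    exact mul_lt_mul_of_pos_left (by exact_mod_cast hj) hpi
  have hsin0 : ∀ j : ℕ, j ≤ N → 0 ≤ b * Real.sin (Real.pi * j / N) := fun j hj =>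
    mul_nonneg hb.le (Real.sin_nonneg_of_nonneg_of_le_pi (by positivity) (hle j hj))
  have hsinpos : ∀ j : ℕ, 0 < j → j < N → 0 < b * Real.sin (Real.pi * j / N) := fun j hj hj' =>
    mul_pos hb (Real.sin_pos_of_pos_of_lt_pi (by positivity) (hlt j hj'))
  have htop : ∀ j < N, crossing θ (ellipseCurve a b θ (Real.pi * j / N))
      (ellipseCurve a b θ (Real.pi * (j + 1 : ℕ) / N)) = 0 := by
    intro j hj
    rw [crossing, crossingSign, height_ellipseCurve, height_ellipseCurve,
      if_neg (not_lt.2 (hsin0 j hj.le)), if_neg fun h => (hsin0 (j + 1) hj).not_gt h.1]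
  have hbot : ∀ j < N, crossing θ (ellipseCurve a b θ (-(Real.pi * (j + 1 : ℕ) / N)))
      (ellipseCurve a b θ (-(Real.pi * j / N))) = if j = 0 then 1 else 0 := by
    intro j hj
    have hdet : 0 < a * b * Real.sin (Real.pi / N) := by positivity
    have harg : -(Real.pi * j / N) - -(Real.pi * (j + 1 : ℕ) / N) = Real.pi / N := by
      rw [← hstep j]; ring
    rw [crossing, crossingSign, height_ellipseCurve, height_ellipseCurve, planeDet_ellipseCurve,
      harg, Real.sin_neg, Real.sin_neg, mul_neg, mul_neg]
    rcases Nat.eq_zero_or_pos j with rfl | hj0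
    · rw [if_pos (neg_neg_iff_pos.2 (hsinpos 1 one_pos (by omega))), if_pos ⟨by simp, hdet⟩,
        if_pos rfl]
    · rw [if_neg hj0.ne']
      split_ifs with h1 h2 h3
      · exact absurd h2.1 (not_le.2 (neg_neg_iff_pos.2 (hsinpos j hj0 hj)))
      · rfl
      · exact absurd h3.2 hdet.not_gt
      · rfl
  rw [loopChain, map_sum]
  have : ∀ j ∈ Finset.range N, winding k θ
      (edge k (ellipseCurve a b θ (Real.pi * j / N))
          (ellipseCurve a b θ (Real.pi * (j + 1 : ℕ) / N)) +
        edge k (ellipseCurve a b θ (-(Real.pi * (j + 1 : ℕ) / N)))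
          (ellipseCurve a b θ (-(Real.pi * j / N)))) = if j = 0 then 1 else 0 := by
    intro j hj
    rw [map_add, winding_edge, winding_edge, htop j (Finset.mem_range.1 hj),
      hbot j (Finset.mem_range.1 hj)]
    split_ifs <;> simp
  rw [Finset.sum_congr rfl this, Finset.sum_ite_eq' (Finset.range N) 0,
    if_pos (Finset.mem_range.2 (by omega))]

end Curve

/-! ### Loops in the filtrations -/

section Filtrations

theorem spans_cech {X : Type} [MetricSpace X] {P T : Set X} {r : ℝ} (hfin : T.Finite)
    (hne : T.Nonempty) (hT : T ⊆ P) (c : X) (hc : ∀ p ∈ T, dist p c ≤ r) : Spans (cech P r) T :=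
  ⟨hfin.toFinset, ⟨hfin.toFinset_nonempty.2 hne, by simpa using hT, c, by simpa using hc⟩, by simp⟩

theorem cech_le_rips {X : Type} [MetricSpace X] (P : Set X) (r : ℝ) : cech P r ≤ rips P r := by
  rintro s ⟨hne, hP, c, hc⟩
  refine ⟨hne, hP, fun p hp q hq => ?_⟩
  have := dist_triangle_right p q c
  linarith [hc p hp, hc q hq]

variable {k : Type*} [Field k] {V : Type}

/-- A filtration by subcomplexes on a finite vertex set takes finitely many values, so every nonempty
set of parameters contains one, `r₀`, at which it takes the least value on that set: the filtration
is constant on the part of the set up to `r₀`. -/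
theorem exists_bijective_transition (F : ℝ →o PreAbstractSimplicialComplex V) {P : Set V}
    (hP : P.Finite) (hF : ∀ r, ∀ s ∈ F r, (s : Set V) ⊆ P) (J : Set ℝ) (hJ : J.Nonempty) :
    ∃ r₀ ∈ J, ∀ r ∈ J, ∀ h : r ≤ r₀,
      Function.Bijective (transition (persistentHomology k F 1) h) := by
  have hfinite : ∀ r, (F r : Set (Finset V)).Finite := fun r =>
    (hP.finite_subsets.preimage Finset.coe_injective.injOn).subset fun s hs => hF r s hs
  obtain ⟨r₀, hr₀, hmin⟩ := exists_minimalFor_of_wellFoundedLT (· ∈ J)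
    (fun r => (F r : Set (Finset V)).ncard) hJ
  refine ⟨r₀, hr₀, fun r hr h => ?_⟩
  have hsub : (F r : Set (Finset V)) ⊆ F r₀ := F.monotone h
  have heq : F r = F r₀ := SetLike.coe_injective (Set.eq_of_subset_of_ncard_le hsub
    (hmin hr (Set.ncard_le_ncard hsub (hfinite r₀))) (hfinite r₀))
  have hinv : ∀ x : Homology k (F r) 1,
      homologyMap k heq.ge 1 (homologyMap k (F.monotone h) 1 x) = x := by
    intro x
    obtain ⟨x, rfl⟩ := Submodule.Quotient.mk_surjective _ x
    rfl
  have hinv' : ∀ x : Homology k (F r₀) 1,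
      homologyMap k (F.monotone h) 1 (homologyMap k heq.ge 1 x) = x := by
    intro x
    obtain ⟨x, rfl⟩ := Submodule.Quotient.mk_surjective _ x
    rfl
  exact Function.bijective_iff_has_inverse.2 ⟨homologyMap k heq.ge 1, hinv, hinv'⟩

variable (k) in
open Classical in
/-- The class of the polygon `loopChain k g N` in the first homology of `K` (and `0` when the polygon
is not a cycle of `K`). -/
def loopClass (K : PreAbstractSimplicialComplex V) (g : ℝ → V) (N : ℕ) : Homology k K 1 :=
  if h : loopChain k g N ∈ cycles k K 1 then Submodule.Quotient.mk ⟨_, h⟩ else 0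

theorem loopClass_eq_zero_iff {K : PreAbstractSimplicialComplex V} {g : ℝ → V} {N : ℕ}
    (h : loopChain k g N ∈ cycles k K 1) :
    loopClass k K g N = 0 ↔ loopChain k g N ∈ boundaries k K 1 := by
  rw [loopClass, dif_pos h, Submodule.Quotient.mk_eq_zero]
  rfl

theorem loopClass_eq_iff {K : PreAbstractSimplicialComplex V} {g g' : ℝ → V} {N N' : ℕ}
    (h : loopChain k g N ∈ cycles k K 1) (h' : loopChain k g' N' ∈ cycles k K 1) :
    loopClass k K g N = loopClass k K g' N' ↔
      (boundaries k K 1).mkQ (loopChain k g N) = (boundaries k K 1).mkQ (loopChain k g' N') := by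
  rw [loopClass, loopClass, dif_pos h, dif_pos h', Submodule.mkQ_apply, Submodule.mkQ_apply,
    Submodule.Quotient.eq, Submodule.Quotient.eq]
  rfl

theorem transition_loopClass (F : ℝ →o PreAbstractSimplicialComplex V) {r s : ℝ} (h : r ≤ s)
    {g : ℝ → V} {N : ℕ} (hr : loopChain k g N ∈ cycles k (F r) 1) :
    transition (persistentHomology k F 1) h (loopClass k (F r) g N) = loopClass k (F s) g N := by
  rw [loopClass, loopClass, dif_pos hr, dif_pos (cycles_mono k (F.monotone h) 1 hr)]
  rfl

theorem subsingleton_persistentHomology {X : Type} [MetricSpace X] {P : Set X}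
    {F : ℝ →o PreAbstractSimplicialComplex X} (hF : ∀ r, F r ≤ rips P r) {r : ℝ} (hr : r ≤ 0) :
    Subsingleton ((persistentHomology k F 1).obj r) :=
  subsingleton_homology_one k fun s hs p hp q hq =>
    dist_le_zero.1 (((hF r hs).2.2 p hp q hq).trans (by linarith))

/-- Let the ellipse with radii `β ≤ a` lie in `W`, which lies outside the open disc of radius `β`,
and let `g` follow the ellipse within `P` up to an error `δ`. The loop `g` gives a compatible
family of classes in any filtration `F` containing the Čech filtration of `P`. They are nonzero as
long as the faces of `F` avoid the origin, by winding, and zero after `β + δ`, since the chords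
parallel to the second axis sweep out the loop. -/
theorem exists_loop_family {P W : Set (EuclideanSpace ℝ (Fin 2))} {a β δ β₁ θ : ℝ} (hβ : 0 < β)
    (hβa : β ≤ a) (hδ : 0 ≤ δ) (hβ₁ : β₁ ≤ β) (hW : ellipse a β θ ⊆ W) (hWn : ∀ p ∈ W, β ≤ ‖p‖)
    (hPW : P ⊆ W) (F : ℝ →o PreAbstractSimplicialComplex (EuclideanSpace ℝ (Fin 2)))
    (hF : ∀ r, cech P r ≤ F r) (hav : ∀ r < β₁, AvoidsOrigin (F r))
    (g : ℝ → EuclideanSpace ℝ (Fin 2)) (hgP : ∀ t, g t ∈ P)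
    (hgd : ∀ t, dist (g t) (ellipseCurve a β θ t) ≤ δ) (hgπ : g Real.pi = g (-Real.pi)) :
    ∃ x : ∀ r, (persistentHomology k F 1).obj r,
      (∀ (r s : ℝ) (h : r ≤ s), δ < r → transition (persistentHomology k F 1) h (x r) = x s) ∧
      (∀ r, δ < r → r < β₁ → x r ≠ 0) ∧ ∀ r, β + δ < r → x r = 0 := by
  have hpi := Real.pi_pos
  have ha : 0 < a := hβ.trans_le hβa
  -- Polygons with `2 ^ m` vertices on each half are fine enough at scale `r` when `fine r m`.
  let fine : ℝ → ℕ → Prop := fun r m => 1 ≤ m ∧ 2 * a * (Real.pi / (2 ^ m : ℕ)) ≤ r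
  have hfine : ∀ r, 0 < r → ∃ m, fine r m := by
    intro r hr
    obtain ⟨n, hn⟩ := exists_nat_gt (2 * a * Real.pi / r)
    refine ⟨n + 1, by omega, ?_⟩
    have h2 : (n : ℝ) ≤ (2 ^ (n + 1) : ℕ) := by
      exact_mod_cast (Nat.lt_two_pow_self.le.trans (Nat.pow_le_pow_right (by norm_num) n.le_succ))
    rw [← mul_div_assoc, div_le_iff₀ (by positivity)]
    rw [div_lt_iff₀ hr] at hn
    nlinarith
  have hγ : ∀ {r : ℝ} {m : ℕ} {s t : ℝ}, fine r m → |s - t| ≤ Real.pi / (2 ^ m : ℕ) →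
      dist (ellipseCurve a β θ s) (ellipseCurve a β θ t) ≤ r := fun hm hst =>
    (dist_ellipseCurve_le hβ.le hβa θ _ _).trans
      ((mul_le_mul_of_nonneg_left hst (by positivity)).trans hm.2)
  have hg : ∀ {r : ℝ} {m : ℕ} {s t : ℝ}, fine r m → |s - t| ≤ Real.pi / (2 ^ m : ℕ) →
      dist (g s) (ellipseCurve a β θ t) ≤ r + δ := by
    intro r m s t hm hst
    linarith [hgd s, hγ hm hst,
      dist_triangle (g s) (ellipseCurve a β θ s) (ellipseCurve a β θ t)]
  have hfine0 : ∀ {r : ℝ} {m : ℕ}, fine r m → 0 ≤ r := fun h => le_trans (by positivity) h.2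
  have htriple : ∀ {r : ℝ} {m : ℕ}, fine (r - δ) m → ∀ s t u : ℝ,
      |s - t| ≤ Real.pi / (2 ^ m : ℕ) → |u - t| ≤ Real.pi / (2 ^ m : ℕ) →
      Spans (F r) {g s, g t, g u} := by
    intro r m hm s t u hs hu
    refine (spans_cech (P := P) (r := r) (Set.toFinite _) ⟨g s, by simp⟩ ?_
      (ellipseCurve a β θ t) ?_).mono (hF r) subset_rfl
    · rintro _ (rfl | rfl | rfl) <;> exact hgP _
    · have := hfine0 hm
      rintro _ (rfl | rfl | rfl)
      · linarith [hg hm hs]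
      · linarith [hgd t]
      · linarith [hg hm hu]
  have hcyc : ∀ {r : ℝ} {m : ℕ}, fine (r - δ) m →
      loopChain k g (2 ^ m) ∈ cycles k (F r) 1 := by
    intro r m hm
    refine loopChain_mem_cycles (by positivity) hgπ fun s t hst => ?_
    exact (htriple hm s t t hst (by simp; positivity)).mono le_rfl (by simp)
  have hrefine : ∀ {r : ℝ} {m m' : ℕ}, fine (r - δ) m → fine (r - δ) m' →
      loopClass k (F r) g (2 ^ m) = loopClass k (F r) g (2 ^ m') := by
    intro r m m' hm hm'
    rw [loopClass_eq_iff (hcyc hm) (hcyc hm')]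
    rcases le_total m m' with h | h
    · exact (mkQ_loopChain_two_pow h (htriple hm)).symm
    · exact mkQ_loopChain_two_pow h (htriple hm')
  have hM : ∀ r, ∃ m, δ < r → fine (r - δ) m := by
    intro r
    by_cases hr : δ < r
    · obtain ⟨m, hm⟩ := hfine (r - δ) (sub_pos.2 hr)
      exact ⟨m, fun _ => hm⟩
    · exact ⟨0, fun h => absurd h hr⟩
  choose m hm using hM
  refine ⟨fun r => loopClass k (F r) g (2 ^ m r), fun r s h hr => ?_, fun r hr hrβ h0 => ?_,
    fun r hr => ?_⟩
  · rw [transition_loopClass F h (hcyc (hm r hr))]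
    exact hrefine ⟨(hm r hr).1, (hm r hr).2.trans (by linarith)⟩ (hm s (hr.trans_le h))
  · have hb := (loopClass_eq_zero_iff (hcyc (hm r hr))).1 h0
    have hg0 := winding_boundaries k (hav r hrβ) θ hb
    -- In the Čech complex of `W` the loop is homologous to a polygon inscribed in the ellipse.
    have hcongr : (boundaries k (cech W r) 1).mkQ
          (loopChain k (ellipseCurve a β θ) (2 ^ m r)) =
        (boundaries k (cech W r) 1).mkQ (loopChain k g (2 ^ m r)) := by
      refine mkQ_loopChain_congr (by positivity) (ellipseCurve_pi a β θ) hgπ fun s t hst => ?_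
      refine spans_cech (Set.toFinite _) ⟨g s, by simp⟩ ?_ (ellipseCurve a β θ t) ?_
      · rintro _ (rfl | rfl | rfl | rfl)
        · exact hW (ellipseCurve_mem a β θ s)
        · exact hW (ellipseCurve_mem a β θ t)
        · exact hPW (hgP s)
        · exact hPW (hgP t)
      · rintro _ (rfl | rfl | rfl | rfl)
        · linarith [hγ (hm r hr) hst]
        · rw [dist_self]; linarith
        · linarith [hg (hm r hr) hst]
        · linarith [hgd t]
    rw [Submodule.mkQ_apply, Submodule.mkQ_apply, Submodule.Quotient.eq] at hcongr
    have hw := winding_boundaries k (avoidsOrigin_cech hWn (hrβ.trans_le hβ₁)) θ hcongr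
    have hN : 2 ≤ 2 ^ m r := by
      calc 2 = 2 ^ 1 := rfl
        _ ≤ 2 ^ m r := Nat.pow_le_pow_right (by norm_num) (hm r hr).1
    rw [map_sub, hg0, winding_loopChain k ha hβ θ hN, sub_zero] at hw
    exact one_ne_zero hw
  · have hrδ : δ < r := by linarith
    obtain ⟨m₁, hm₁⟩ := hfine (r - δ - β) (by linarith)
    have hm₁' : fine (r - δ) m₁ := ⟨hm₁.1, hm₁.2.trans (by linarith)⟩
    change loopClass k (F r) g (2 ^ m r) = 0
    rw [hrefine (hm r hrδ) hm₁', loopClass_eq_zero_iff (hcyc hm₁')]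
    refine loopChain_mem_boundaries (by positivity) hgπ fun s t hst => ?_
    refine (spans_cech (P := P) (r := r) (Set.toFinite _) ⟨g s, by simp⟩ ?_
      (axisPoint a θ s) ?_).mono (hF r) subset_rfl
    · rintro _ (rfl | rfl | rfl | rfl) <;> exact hgP _
    · have h0 := hfine0 hm₁
      have hpos := dist_axisPoint_le a θ s hβ.le
      have hneg := dist_axisPoint_neg_le a θ s hβ.le
      rintro _ (rfl | rfl | rfl | rfl)
      · linarith [hgd s, dist_triangle (g s) (ellipseCurve a β θ s) (axisPoint a θ s)]
      · linarith [hg hm₁ (abs_sub_comm s t ▸ hst),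
          dist_triangle (g t) (ellipseCurve a β θ s) (axisPoint a θ s)]
      · linarith [hgd (-s), dist_triangle (g (-s)) (ellipseCurve a β θ (-s)) (axisPoint a θ s)]
      · have hst' : |-t - -s| ≤ Real.pi / (2 ^ m₁ : ℕ) := by rwa [neg_sub_neg]
        linarith [hg hm₁ hst',
          dist_triangle (g (-t)) (ellipseCurve a β θ (-s)) (axisPoint a θ s)]

end Filtrations

/-! ### Bars of the union of ellipses -/

section Main

variable {k : Type*} [Field k]

/-- The loop of the ellipse itself, in a filtration of all of `W`. -/
theorem exists_isDiagramPoint_continuous {W : Set (EuclideanSpace ℝ (Fin 2))} {a β β₁ θ : ℝ}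
    (hβ : 0 < β) (hβa : β ≤ a) (hβ₁0 : 0 < β₁) (hβ₁ : β₁ ≤ β) (hW : ellipse a β θ ⊆ W)
    (hWn : ∀ p ∈ W, β ≤ ‖p‖) (F : ℝ →o PreAbstractSimplicialComplex (EuclideanSpace ℝ (Fin 2)))
    (hF : ∀ r, cech W r ≤ F r) (hF' : ∀ r, F r ≤ rips W r) (hav : ∀ r < β₁, AvoidsOrigin (F r)) :
    ∃ d, β₁ ≤ d ∧ d ≤ β ∧ IsDiagramPoint (persistentHomology k F 1) 0 d := by
  obtain ⟨x, hmap, hne, h0⟩ := exists_loop_family (k := k) (P := W) (δ := 0) hβ hβa le_rfl hβ₁ hW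
    hWn subset_rfl F hF hav (ellipseCurve a β θ) (fun t => hW (ellipseCurve_mem a β θ t))
    (fun t => (dist_self _).le) (ellipseCurve_pi a β θ)
  exact isDiagramPoint_of_family _ hβ₁0 (fun r hr => subsingleton_persistentHomology hF' hr) x hmap
    hne fun r hr => h0 r (by simpa using hr)

/-- The loop that follows the ellipse through nearby points of a finite `δ`-dense sample `P`. -/
theorem exists_isDiagramPoint_discrete {P W : Set (EuclideanSpace ℝ (Fin 2))} {a β β₁ δ θ : ℝ}
    (hβ : 0 < β) (hβa : β ≤ a) (hδβ : δ < β₁) (hβ₁ : β₁ ≤ β) (hW : ellipse a β θ ⊆ W)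
    (hWn : ∀ p ∈ W, β ≤ ‖p‖) (hPW : P ⊆ W) (hP : P.Finite)
    (hdense : ∀ x ∈ W, ∃ p ∈ P, dist x p ≤ δ)
    (F : ℝ →o PreAbstractSimplicialComplex (EuclideanSpace ℝ (Fin 2)))
    (hF : ∀ r, cech P r ≤ F r) (hF' : ∀ r, F r ≤ rips P r) (hav : ∀ r < β₁, AvoidsOrigin (F r)) :
    ∃ b d, 0 ≤ b ∧ b ≤ δ ∧ β₁ ≤ d ∧ d ≤ β + δ ∧
      IsDiagramPoint (persistentHomology k F 1) b d := by
  choose! f hfP hfd using hdense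
  have hγ : ∀ t, ellipseCurve a β θ t ∈ W := fun t => hW (ellipseCurve_mem a β θ t)
  have hδ : 0 ≤ δ := dist_nonneg.trans (hfd _ (hγ 0))
  obtain ⟨x, hmap, hne, h0⟩ := exists_loop_family (k := k) (P := P) (δ := δ) hβ hβa hδ hβ₁ hW
    hWn hPW F hF hav (fun t => f (ellipseCurve a β θ t)) (fun t => hfP _ (hγ t))
    (fun t => by rw [dist_comm]; exact hfd _ (hγ t)) (by rw [ellipseCurve_pi])
  refine isDiagramPoint_of_class _ hδ hδβ (by linarith)
    (fun r hr => subsingleton_persistentHomology hF' hr)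
    (exists_bijective_transition F hP fun r s hs => (hF' r hs).2.1)
    fun c hc _ => ⟨x c, fun r h hr => ?_, fun r h hr => ?_⟩
  · rw [hmap c r h hc]
    exact hne r (hc.trans_le h) hr
  · rw [hmap c r h hc]
    exact h0 r hr

/-- Both radii are positive away from the multiples of `T / 2`. -/
theorem radius_pos {A T τ : ℝ} (hA : 0 < A) (hT : 0 < T) (hτ : ∀ m : ℤ, τ ≠ m * (T / 2)) :
    0 < radiusPlus A T τ ∧ 0 < radiusMinus A T τ := by
  have hpi := Real.pi_pos
  have hsin : Real.sin (2 * Real.pi * τ / T) ≠ 0 := by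
    rw [Ne, Real.sin_eq_zero_iff]
    rintro ⟨m, hm⟩
    apply hτ m
    field_simp at hm
    linarith
  have hsq := Real.sin_sq_add_cos_sq (2 * Real.pi * τ / T)
  have hs : 0 < Real.sin (2 * Real.pi * τ / T) ^ 2 := by positivity
  have hp : 0 < 1 + Real.cos (2 * Real.pi * τ / T) := by
    nlinarith [Real.cos_le_one (2 * Real.pi * τ / T), Real.neg_one_le_cos (2 * Real.pi * τ / T)]
  have hm : 0 < 1 - Real.cos (2 * Real.pi * τ / T) := by
    nlinarith [Real.cos_le_one (2 * Real.pi * τ / T), Real.neg_one_le_cos (2 * Real.pi * τ / T)]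
  exact ⟨mul_pos hA (Real.sqrt_pos.2 hp), mul_pos hA (Real.sqrt_pos.2 hm)⟩

end Main

end

theorem lemma4 (k : Type*) [Field k] (n : ℕ) (A T θ : Fin n → ℝ) (τ βs : ℝ)
    (hA : ∀ i, 0 < A i) (hT : ∀ i, 0 < T i)
    (hτ : ∀ (i : Fin n) (m : ℤ), τ ≠ m * (T i / 2))
    (hθ : ∀ i, θ i = Real.pi / 4 ∨ θ i = -(Real.pi / 4))
    (hβ : IsLeast (⋃ i, {radiusPlus (A i) (T i) τ, radiusMinus (A i) (T i) τ}) βs) :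
    IsDiagramPoint (persistentHomology k (cech (ellipseUnion A T θ τ)) 1) 0 βs ∧
    (∃ d, √3 / 2 * βs ≤ d ∧ d ≤ βs ∧
      IsDiagramPoint (persistentHomology k (rips (ellipseUnion A T θ τ)) 1) 0 d) ∧
    ∀ (P : Set (EuclideanSpace ℝ (Fin 2))) (δ : ℝ), P.Finite → P ⊆ ellipseUnion A T θ τ →
      (∀ x ∈ ellipseUnion A T θ τ, ∃ p ∈ P, dist x p ≤ δ) →
      (δ < βs → ∃ b d, 0 ≤ b ∧ b ≤ δ ∧ βs ≤ d ∧ d ≤ βs + δ ∧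
        IsDiagramPoint (persistentHomology k (cech P) 1) b d) ∧
      (δ < √3 / 2 * βs → ∃ b d, 0 ≤ b ∧ b ≤ δ ∧ √3 / 2 * βs ≤ d ∧ d ≤ βs + δ ∧
        IsDiagramPoint (persistentHomology k (rips P) 1) b d) := by
  have hle : ∀ i, βs ≤ radiusPlus (A i) (T i) τ ∧ βs ≤ radiusMinus (A i) (T i) τ := fun i =>
    ⟨hβ.2 (Set.mem_iUnion.2 ⟨i, by simp⟩), hβ.2 (Set.mem_iUnion.2 ⟨i, by simp⟩)⟩
  obtain ⟨i, hi⟩ := Set.mem_iUnion.1 hβ.1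
  have hpos := radius_pos (hA i) (hT i) (hτ i)
  have hβ0 : 0 < βs := by
    rcases hi with rfl | rfl
    exacts [hpos.1, hpos.2]
  set W := ellipseUnion A T θ τ with hWdef
  have hWn : ∀ p ∈ W, βs ≤ ‖p‖ := by
    intro p hp
    obtain ⟨j, hj⟩ := Set.mem_iUnion.1 hp
    exact le_norm_of_mem_ellipse hβ0.le (hle j).1 (hle j).2 hj
  have hsub : ellipse (radiusPlus (A i) (T i) τ) (radiusMinus (A i) (T i) τ) (θ i) ⊆ W :=
    Set.subset_iUnion
      (fun i => ellipse (radiusPlus (A i) (T i) τ) (radiusMinus (A i) (T i) τ) (θ i)) i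
  -- Turn the ellipse so that its second radius is the smaller one.
  obtain ⟨a, φ, hβa, hW⟩ : ∃ a φ, βs ≤ a ∧ ellipse a βs φ ⊆ W := by
    rcases hi with rfl | rfl
    · exact ⟨_, _, (hle i).2, (ellipse_add_pi_div_two _ _ _).trans hsub⟩
    · exact ⟨_, _, (hle i).1, hsub⟩
  have h3 : √3 / 2 * βs ≤ βs := by
    have : √3 ≤ 2 := Real.sqrt_le_iff.2 ⟨by norm_num, by norm_num⟩
    nlinarith
  have h30 : 0 < √3 / 2 * βs := by positivity
  refine ⟨?_, ?_, fun P δ hP hPW hd => ⟨fun hδ => ?_, fun hδ => ?_⟩⟩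
  · obtain ⟨d, h1, h2, h⟩ := exists_isDiagramPoint_continuous (k := k) hβ0 hβa hβ0 le_rfl hW hWn
      (cech W) (fun r => le_rfl) (cech_le_rips W) fun r hr => avoidsOrigin_cech hWn hr
    rwa [le_antisymm h1 h2]
  · exact exists_isDiagramPoint_continuous hβ0 hβa h30 h3 hW hWn (rips W) (cech_le_rips W)
      (fun r => le_rfl) fun r hr => avoidsOrigin_rips hβ0.le hWn hr
  · exact exists_isDiagramPoint_discrete hβ0 hβa hδ le_rfl hW hWn hPW hP hd (cech P)
      (fun r => le_rfl) (cech_le_rips P) fun r hr => avoidsOrigin_cech (fun p hp => hWn p (hPW hp)) hr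
  · exact exists_isDiagramPoint_discrete hβ0 hβa hδ h3 hW hWn hPW hP hd (rips P) (cech_le_rips P)
      (fun r => le_rfl) fun r hr => avoidsOrigin_rips hβ0.le (fun p hp => hWn p (hPW hp)) hr
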